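/- **Theorem (Exponential convergence of low-rank projected gradient descent for filter-based supervised dictionary learning).** *Setting.* Let $\mathbf X_{\rm data}=[\mathbf x_1,\dots,\mathbf x_n]\in\mathbb R^{p\times n}$, $\mathbf X_{\rm aux}=[\mathbf x_1',\dots,\mathbf x_n']\in\mathbb R^{q\times n}$, labels $y_1,\dots,y_n\in\{0,1,\dots,\kappa\}$, and let $h:\mathbb R\to[0,\infty)$ be a score function. For $\mathbf a\in\mathbb R^\kappa$ put $S(\mathbf a)=1+\sum_{c=1}^\kappa h(a_c)$, $g_0(\mathbf a)=1/S(\mathbf a)$, $g_j(\mathbf a)=h(a_j)/S(\mathbf a)$ for $1\le j\le\kappa$, and $\ell(y,\mathbf a)=-\log g_y(\mathbf a)$. Parameters are $\mathbf Z=[\mathbf X,\boldsymbol\Gamma]$ with $\mathbf X=[\mathbf A,\mathbf B]\in\mathbb R^{p\times(\kappa+n)}$ and $\boldsymbol\Gamma\in\mathbb R^{q\times\kappa}$, with the Frobenius inner product and norm. The activations are $\mathbf a_s(\mathbf Z)=\mathbf A^T\mathbf x_s+\boldsymbol\Gamma^T\mathbf x_s'$, and for $\xi\in\mathbb R$, $\nu\ge0$,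 $$f(\mathbf Z)=\sum_{s=1}^n\ell(y_s,\mathbf a_s(\mathbf Z))+\xi\|\mathbf X_{\rm data}-\mathbf B\|_F^2+\nu\left(\|\mathbf A\|_F^2+\|\boldsymbol\Gamma\|_F^2\right).$$ Given a constraint set $\boldsymbol\Theta\subseteq\mathbb R^{p\times(\kappa+n)}\times\mathbb R^{q\times\kappa}$, a rank parameter $r$, a stepsize $\tau$ and any starting point $\mathbf Z_0$, let $$\mathbf Z_{t}=\Pi_r\big(\Pi_{\boldsymbol\Theta}(\mathbf Z_{t-1}-\tau\nabla f(\mathbf Z_{t-1}))\big),\qquad t=1,\dots,N,$$ where $\Pi_{\boldsymbol\Theta}$ is the nearest-point projection and $\Pi_r$ replaces the factor $\mathbf X$ by a best Frobenius-norm approximation of rank $\le r$ (any choice if not unique) and keeps $\boldsymbol\Gamma$. *Assumptions.* (A1) $\boldsymbol\Theta$ is convex (and the projections onto it that are used below exist, e.g. because it is closed). (A2) For some $M\in(0,\infty)$, $\|\mathbf a_s(\mathbf Z)\|\le M$ for all $s$ and for every parameter $\mathbf Z$ that occurs below: the iterates $\mathbf Z_0,\dots,\mathbf Z_N$ and the reference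 points $\mathbf Z^\star$, $\mathbf Z^*$. (A3) With $\boldsymbol\Phi=[\mathbf X_{\rm data}^T,\mathbf X_{\rm aux}^T]^T$, there are $\delta^-,\delta^+>0$ with $\delta^-\le\lambda_{\min}(n^{-1}\boldsymbol\Phi\boldsymbol\Phi^T)\le\lambda_{\max}(n^{-1}\boldsymbol\Phi\boldsymbol\Phi^T)\le\delta^+$. (A4) $h$ is twice continuously differentiable. Let $\dot{\mathbf h}(y,\mathbf a)\in\mathbb R^\kappa$ and $\ddot{\mathbf H}(y,\mathbf a)\in\mathbb R^{\kappa\times\kappa}$ have the entries $$\dot h_j=\frac{h'(a_j)}{S(\mathbf a)}-\mathbf 1(y=j)\frac{h'(a_j)}{h(a_j)},\qquad \ddot H_{ij}=\frac{h''(a_j)\mathbf 1(i=j)}{S(\mathbf a)}-\frac{h'(a_i)h'(a_j)}{S(\mathbf a)^2}-\mathbf 1(y=i=j)\Big(\frac{h''(a_j)}{h(a_j)}-\frac{h'(a_j)^2}{h(a_j)^2}\Big).$$ Then $\sup_{\|\mathbf a\|<M}\max_s\|\dot{\mathbf h}(y_s,\mathbf a)\|_\infty$, $\alpha^-:=\inf_{\|\mathbf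 a\|<M}\min_s\lambda_{\min}(\ddot{\mathbf H}(y_s,\mathbf a))$ and $\alpha^+:=\sup_{\|\mathbf a\|<M}\max_s\lambda_{\max}(\ddot{\mathbf H}(y_s,\mathbf a))$ are finite and positive. *Constants.* Fix any $\mu^*\le\delta^-\alpha^-$ and $L^*\ge\delta^+\alpha^+$. Let $\mu=\min(2\xi,2\nu+n\mu^*)$ and $L=\max(2\xi,2\nu+nL^*)$, and suppose $\mu>0$ and $L/\mu<3$. Fix $\tau\in(\frac1{2\mu},\frac3{2L})$ and put $\rho=2\max(|1-\tau\mu|,|1-\tau L|)$. *Conclusion.* Then $\rho\in[0,1)$, with $\rho>0$ unless $\mu=L=1/\tau$, and: (i) Let $\mathbf Z^\star=[\mathbf X^\star,\boldsymbol\Gamma^\star]\in\boldsymbol\Theta$ with $\operatorname{rank}(\mathbf X^\star)\le r$, and let $[\Delta\mathbf X^\star,\Delta\boldsymbol\Gamma^\star]=\frac1\tau\big(\mathbf Z^\star-\Pi_{\boldsymbol\Theta}(\mathbf Z^\star-\tau\nabla f(\mathbf Z^\star))\big)$. Then for $1\le t\le N$, $$\|\mathbf Z_t-\mathbf Z^\star\|_F\le\rho^t\|\mathbf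 Z_0-\mathbf Z^\star\|_F+\frac{2\tau}{1-\rho}\left(\sqrt{3r}\,\|\Delta\mathbf X^\star\|_2+\|\Delta\boldsymbol\Gamma^\star\|_F\right),$$ where $\|\cdot\|_2$ is the operator norm. (ii) Let $\mathbf Z^*=[\mathbf X^*,\boldsymbol\Gamma^*]\in\boldsymbol\Theta$ be a stationary point of $f$ over $\boldsymbol\Theta$, i.e. $\langle\nabla f(\mathbf Z^*),\mathbf Z-\mathbf Z^*\rangle\ge0$ for all $\mathbf Z\in\boldsymbol\Theta$, with $\operatorname{rank}(\mathbf X^*)\le r$. Then for $1\le t\le N$, $$\|\mathbf Z_t-\mathbf Z^*\|_F\le\rho^t\|\mathbf Z_0-\mathbf Z^*\|_F,$$ $$f(\mathbf Z_t)-f(\mathbf Z^*)\le\left(\|\nabla f(\mathbf Z^*)\|_F+L\rho^t\|\mathbf Z_0-\mathbf Z^*\|_F\right)\rho^t\|\mathbf Z_0-\mathbf Z^*\|_F.$$ -/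

import Mathlib

noncomputable section

namespace SDL

open Matrix

/-- Lifted parameters `Z = [[A, B], Γ]` with `X = [A, B]` a `p × (κ + n)` matrix and `Γ` a
`q × κ` matrix, stored as one Euclidean vector, so that the norm and the inner product of this
space are the Frobenius norm and the Frobenius inner product. -/
abbrev Param (p q κ n : ℕ) : Type :=
  EuclideanSpace ℝ ((Fin p × (Fin κ ⊕ Fin n)) ⊕ (Fin q × Fin κ))

section Blocks

variable {p q κ n : ℕ}

/-- The combined matrix factor `X = [A, B]`. -/
def matX (Z : Param p q κ n) : Matrix (Fin p) (Fin κ ⊕ Fin n) ℝ :=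
  Matrix.of fun i c => Z (Sum.inl (i, c))

/-- The block `A`. -/
def matA (Z : Param p q κ n) : Matrix (Fin p) (Fin κ) ℝ :=
  Matrix.of fun i j => Z (Sum.inl (i, Sum.inl j))

/-- The block `B`. -/
def matB (Z : Param p q κ n) : Matrix (Fin p) (Fin n) ℝ :=
  Matrix.of fun i s => Z (Sum.inl (i, Sum.inr s))

/-- The auxiliary block `Γ`. -/
def matG (Z : Param p q κ n) : Matrix (Fin q) (Fin κ) ℝ :=
  Matrix.of fun k j => Z (Sum.inr (k, j))

end Blocks

open scoped Matrix.Norms.Frobenius in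
/-- The Frobenius norm of a matrix. -/
def frobNorm {m n : Type*} [Fintype m] [Fintype n] (A : Matrix m n ℝ) : ℝ := ‖A‖

open scoped Matrix.Norms.L2Operator in
/-- The operator norm of a matrix for the Euclidean norms (its largest singular value). -/
def opNorm {m n : Type*} [Fintype m] [Fintype n] [DecidableEq n] (A : Matrix m n ℝ) : ℝ := ‖A‖

/-- Smallest eigenvalue of a (nonempty, symmetric) real matrix. -/
def lambdaMin {m : Type*} [Fintype m] [DecidableEq m] (A : Matrix m m ℝ) : ℝ :=
  sInf (spectrum ℝ A)

/-- Largest eigenvalue of a (nonempty, symmetric) real matrix. -/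
def lambdaMax {m : Type*} [Fintype m] [DecidableEq m] (A : Matrix m m ℝ) : ℝ :=
  sSup (spectrum ℝ A)

/-- The predictive distribution on the labels `0, …, κ` for the score function `h` and the
activation `a`; the label `j ≥ 1` is `j.succ` for `j : Fin κ`. -/
def predProb {κ : ℕ} (h : ℝ → ℝ) (a : EuclideanSpace ℝ (Fin κ)) : Fin (κ + 1) → ℝ :=
  Fin.cases (1 / (1 + ∑ c, h (a c))) (fun j => h (a j) / (1 + ∑ c, h (a c)))

/-- Negative log-likelihood of the label `y` at the activation `a`. -/
def nll {κ : ℕ} (h : ℝ → ℝ) (y : Fin (κ + 1)) (a : EuclideanSpace ℝ (Fin κ)) : ℝ :=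
  -∑ j : Fin (κ + 1), (if y = j then 1 else 0) * Real.log (predProb h a j)

/-- The vector `ḣ(y, a)`. -/
def scoreGrad {κ : ℕ} (h : ℝ → ℝ) (y : Fin (κ + 1)) (a : EuclideanSpace ℝ (Fin κ)) :
    Fin κ → ℝ := fun j =>
  deriv h (a j) / (1 + ∑ c, h (a c))
    - (if y = j.succ then 1 else 0) * (deriv h (a j) / h (a j))

/-- The symmetric matrix `Ḧ(y, a)` (observed information). -/
def scoreHess {κ : ℕ} (h : ℝ → ℝ) (y : Fin (κ + 1)) (a : EuclideanSpace ℝ (Fin κ)) :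
    Matrix (Fin κ) (Fin κ) ℝ := Matrix.of fun i j =>
  (deriv (deriv h) (a j) * (if i = j then 1 else 0) / (1 + ∑ c, h (a c))
      - deriv h (a i) * deriv h (a j) / (1 + ∑ c, h (a c)) ^ 2)
    - (if y = i.succ ∧ i = j then 1 else 0)
      * (deriv (deriv h) (a j) / h (a j) - deriv h (a j) ^ 2 / h (a j) ^ 2)

section Problem

variable {p q κ n : ℕ}

/-- Filter-based activation `Aᵀ x_s + Γᵀ x'_s` of the `s`-th sample. -/
def activation (Xdata : Matrix (Fin p) (Fin n) ℝ) (Xaux : Matrix (Fin q) (Fin n) ℝ)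
    (Z : Param p q κ n) (s : Fin n) : EuclideanSpace ℝ (Fin κ) :=
  WithLp.toLp 2 ((matA Z)ᵀ *ᵥ (fun i => Xdata i s) + (matG Z)ᵀ *ᵥ (fun k => Xaux k s))

/-- The objective `f_SDL-filt` of the lifted filter-based problem. -/
def objective (h : ℝ → ℝ) (ξ ν : ℝ) (Xdata : Matrix (Fin p) (Fin n) ℝ)
    (Xaux : Matrix (Fin q) (Fin n) ℝ) (y : Fin n → Fin (κ + 1)) (Z : Param p q κ n) : ℝ :=
  (∑ s, nll h (y s) (activation Xdata Xaux Z s)) + ξ * frobNorm (Xdata - matB Z) ^ 2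
    + ν * (frobNorm (matA Z) ^ 2 + frobNorm (matG Z) ^ 2)

/-- The activations of all samples at the parameter `Z` have norm at most `M`. -/
def BoundedActivation (Xdata : Matrix (Fin p) (Fin n) ℝ) (Xaux : Matrix (Fin q) (Fin n) ℝ)
    (M : ℝ) (Z : Param p q κ n) : Prop :=
  ∀ s, ‖activation Xdata Xaux Z s‖ ≤ M

/-- The empirical covariance matrix `n⁻¹ Φ Φᵀ` of the stacked data `Φ`. -/
def covariance (Xdata : Matrix (Fin p) (Fin n) ℝ) (Xaux : Matrix (Fin q) (Fin n) ℝ) :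
    Matrix (Fin p ⊕ Fin q) (Fin p ⊕ Fin q) ℝ :=
  (n : ℝ)⁻¹ • (Matrix.fromRows Xdata Xaux * (Matrix.fromRows Xdata Xaux)ᵀ)

/-- Bounded eigenvalues of the empirical covariance matrix. -/
def CovarianceBounds (Xdata : Matrix (Fin p) (Fin n) ℝ) (Xaux : Matrix (Fin q) (Fin n) ℝ)
    (δm δp : ℝ) : Prop :=
  0 < δm ∧ 0 < δp ∧ δm ≤ lambdaMin (covariance Xdata Xaux) ∧
    lambdaMax (covariance Xdata Xaux) ≤ δp

/-- Bounded stiffness and eigenvalues of the observed information: the score function is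
nonnegative and `C²`, and over all activations with `‖a‖ < M` and all samples, the numbers
`‖ḣ(y_s, a)‖_∞` have a finite positive supremum, the smallest eigenvalues of `Ḧ(y_s, a)` have the
positive infimum `αm`, and the largest eigenvalues have the finite positive supremum `αp`. -/
structure InformationBounds (h : ℝ → ℝ) (y : Fin n → Fin (κ + 1)) (M αm αp : ℝ) : Prop where
  nonneg : ∀ u, 0 ≤ h u
  contDiff : ContDiff ℝ 2 h
  gamma : ∃ γ : ℝ, 0 < γ ∧
    IsLUB {v : ℝ | ∃ a : EuclideanSpace ℝ (Fin κ), ‖a‖ < M ∧ ∃ s, v = ‖scoreGrad h (y s) a‖} γ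
  alpham_pos : 0 < αm
  alphap_pos : 0 < αp
  alpham : IsGLB
    {v : ℝ | ∃ a : EuclideanSpace ℝ (Fin κ), ‖a‖ < M ∧ ∃ s, v = lambdaMin (scoreHess h (y s) a)} αm
  alphap : IsLUB
    {v : ℝ | ∃ a : EuclideanSpace ℝ (Fin κ), ‖a‖ < M ∧ ∃ s, v = lambdaMax (scoreHess h (y s) a)} αp

/-- `P` is a nearest point of `Θ` to `Z`, that is, `P = Π_Θ(Z)`. -/
def IsNearest (Θ : Set (Param p q κ n)) (Z P : Param p q κ n) : Prop :=
  P ∈ Θ ∧ ∀ W ∈ Θ, ‖P - Z‖ ≤ ‖W - Z‖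

/-- `P` is a rank-`r` projection `Π_r(Z)`: the matrix factor is replaced by a best approximation of
rank at most `r` in Frobenius norm, and `Γ` is kept. -/
def IsRankProj (r : ℕ) (Z P : Param p q κ n) : Prop :=
  matG P = matG Z ∧ (matX P).rank ≤ r ∧
    ∀ Y : Matrix (Fin p) (Fin κ ⊕ Fin n) ℝ, Y.rank ≤ r →
      frobNorm (matX P - matX Z) ≤ frobNorm (Y - matX Z)

/-- `Z 0, …, Z N` are produced by `N` iterations of low-rank projected gradient descent with
objective `f`, constraint set `Θ`, rank parameter `r` and stepsize `τ`. -/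
def IsLPGDRun (f : Param p q κ n → ℝ) (Θ : Set (Param p q κ n)) (r : ℕ) (τ : ℝ) (N : ℕ)
    (Z : ℕ → Param p q κ n) : Prop :=
  ∀ t < N, ∃ Y, IsNearest Θ (Z t - τ • gradient f (Z t)) Y ∧ IsRankProj r Y (Z (t + 1))

/-- `Z` is a stationary point of `f` over `Θ`. -/
def IsStationary (f : Param p q κ n → ℝ) (Θ : Set (Param p q κ n)) (Z : Param p q κ n) : Prop :=
  Z ∈ Θ ∧ ∀ W ∈ Θ, 0 ≤ inner ℝ (gradient f Z) (W - Z)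

/-- `G` is the gradient mapping `τ⁻¹ (Z - Π_Θ(Z - τ ∇f(Z)))` of `f` over `Θ` at `Z`. -/
def IsGradientMapping (f : Param p q κ n → ℝ) (Θ : Set (Param p q κ n)) (τ : ℝ)
    (Z G : Param p q κ n) : Prop :=
  ∃ P, IsNearest Θ (Z - τ • gradient f Z) P ∧ G = τ⁻¹ • (Z - P)

end Problem

end SDL

end

namespace SDL

open Matrix

/-! ### Frobenius norm -/

section Frobenius

variable {l m n : Type*} [Fintype l] [Fintype m] [Fintype n]

/-! One iteration is a gradient step, a convex projection and a rank truncation. On parameters with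
bounded activations the Hessian of the objective lies between `μ` and `L`, so the gradient step
contracts by `η = max |1 - τμ| |1 - τL|` (`gradient_step_contraction`), and the convex projection is
nonexpansive (`IsNearest.norm_sub_le`). Rank truncation is not nonexpansive, but relative to a point
of rank at most `r` it at most doubles the distance (`IsRankProj.norm_sub_le`). Hence the rate `ρ =
2η`, and the stepsize window is what makes `η < 1/2`.

If the reference point moves by `-τ G` under its own projected gradient step, each iteration adds an
error from `τ G`. The truncated iterate and the reference point have columns in a common space of
dimension at most `2r`, so only the compression of the matrix block of `G` to that space matters;
this gives an operator norm times a square root of the rank. A stationary point has `G = 0`.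

The Hessian bounds (`objectiveHess_bounds`) combine the eigenvalues of the observed information with
those of the covariance. They are needed only on segments between points with bounded activations,
which keep that bound because activations are linear in the parameter. Differentiating the
likelihood requires a positive score at the observed label; `InformationBounds.score_pos` derives
this from the information bounds. -/

theorem frobNorm_nonneg (A : Matrix m n ℝ) : 0 ≤ frobNorm A := by
  open scoped Matrix.Norms.Frobenius in exact norm_nonneg A

theorem frobNorm_sub_le (A B : Matrix m n ℝ) : frobNorm (A - B) ≤ frobNorm A + frobNorm B := by
  open scoped Matrix.Norms.Frobenius in exact norm_sub_le A B

theorem frobNorm_smul (c : ℝ) (A : Matrix m n ℝ) : frobNorm (c • A) = |c| * frobNorm A := by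
  open scoped Matrix.Norms.Frobenius in exact norm_smul c A

theorem frobNorm_zero : frobNorm (0 : Matrix m n ℝ) = 0 := by
  open scoped Matrix.Norms.Frobenius in exact norm_zero

theorem opNorm_zero [DecidableEq n] : opNorm (0 : Matrix m n ℝ) = 0 := by
  open scoped Matrix.Norms.L2Operator in exact norm_zero

theorem opNorm_nonneg [DecidableEq n] (A : Matrix m n ℝ) : 0 ≤ opNorm A := by
  open scoped Matrix.Norms.L2Operator in exact norm_nonneg A

theorem frobNorm_sq (A : Matrix m n ℝ) : frobNorm A ^ 2 = ∑ i, ∑ j, A i j ^ 2 := by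
  have h : frobNorm A = (∑ i, ∑ j, ‖A i j‖ ^ (2 : ℝ)) ^ (1 / 2 : ℝ) := by
    open scoped Matrix.Norms.Frobenius in exact Matrix.frobenius_norm_def A
  rw [h, ← Real.sqrt_eq_rpow, Real.sq_sqrt]
  · simp
  · positivity

theorem frobNorm_sq_eq_trace (A : Matrix m n ℝ) : frobNorm A ^ 2 = (Aᵀ * A).trace := by
  rw [frobNorm_sq, Finset.sum_comm]
  simp [Matrix.trace, Matrix.mul_apply, sq]

/-- Pythagoras for the orthogonal projection `Q Qᵀ`. -/
theorem frobNorm_sq_eq_add [DecidableEq l] {Q : Matrix m l ℝ} (hQ : Qᵀ * Q = 1)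
    (A : Matrix m n ℝ) :
    frobNorm A ^ 2 = frobNorm (Qᵀ * A) ^ 2 + frobNorm (A - Q * (Qᵀ * A)) ^ 2 := by
  simp only [frobNorm_sq_eq_trace]
  rw [← Matrix.trace_add]
  congr 1
  have h1 : (Q * (Qᵀ * A))ᵀ * (Q * (Qᵀ * A)) = (Qᵀ * A)ᵀ * (Qᵀ * A) := by
    calc _ = Aᵀ * Q * (Qᵀ * Q) * (Qᵀ * A) := by
          simp only [Matrix.transpose_mul, Matrix.transpose_transpose, Matrix.mul_assoc]
      _ = _ := by
          rw [hQ, Matrix.mul_one]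
          simp only [Matrix.transpose_mul, Matrix.transpose_transpose, Matrix.mul_assoc]
  have h2 : Aᵀ * (Q * (Qᵀ * A)) = (Qᵀ * A)ᵀ * (Qᵀ * A) := by
    simp only [Matrix.transpose_mul, Matrix.transpose_transpose, Matrix.mul_assoc]
  have h3 : (Q * (Qᵀ * A))ᵀ * A = (Qᵀ * A)ᵀ * (Qᵀ * A) := by
    simp only [Matrix.transpose_mul, Matrix.transpose_transpose, Matrix.mul_assoc]
  rw [Matrix.transpose_sub, Matrix.sub_mul, Matrix.mul_sub, Matrix.mul_sub, h1, h2, h3]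
  abel

theorem frobNorm_transpose_mul_le [DecidableEq l] {Q : Matrix m l ℝ} (hQ : Qᵀ * Q = 1)
    (A : Matrix m n ℝ) : frobNorm (Qᵀ * A) ≤ frobNorm A := by
  refine le_of_sq_le_sq ?_ (frobNorm_nonneg A)
  rw [frobNorm_sq_eq_add hQ A]
  nlinarith [sq_nonneg (frobNorm (A - Q * (Qᵀ * A)))]

/-- Row `i` of `Qᵀ A` is `Aᵀ` applied to a unit vector, so it has norm at most `opNorm A`, and there
are `d` rows. -/
theorem frobNorm_transpose_mul_le_opNorm {d : ℕ} [DecidableEq n] {Q : Matrix m (Fin d) ℝ}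
    (hQ : Qᵀ * Q = 1) (A : Matrix m n ℝ) : frobNorm (Qᵀ * A) ≤ √d * opNorm A := by
  classical
  refine le_of_sq_le_sq ?_ (mul_nonneg (Real.sqrt_nonneg _) (opNorm_nonneg A))
  rw [mul_pow, Real.sq_sqrt (Nat.cast_nonneg d), frobNorm_sq]
  have key : ∀ i : Fin d, ∑ j, (Qᵀ * A) i j ^ 2 ≤ opNorm A ^ 2 := by
    intro i
    have h1 : ‖WithLp.toLp 2 (Aᵀ *ᵥ (fun k => Q k i))‖
        ≤ opNorm A * ‖(WithLp.toLp 2 (fun k => Q k i) : EuclideanSpace ℝ m)‖ := by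
      open scoped Matrix.Norms.L2Operator in
      have := Matrix.l2_opNorm_mulVec Aᵀ (WithLp.toLp 2 (fun k => Q k i))
      have ht : ‖Aᵀ‖ = ‖A‖ := by
        rw [← Matrix.l2_opNorm_conjTranspose A]
        simp [Matrix.conjTranspose]
        rfl
      rw [ht] at this
      exact this
    have h2 : ‖(WithLp.toLp 2 (fun k => Q k i) : EuclideanSpace ℝ m)‖ = 1 := by
      have : ‖(WithLp.toLp 2 (fun k => Q k i) : EuclideanSpace ℝ m)‖ ^ 2 = 1 := by
        rw [EuclideanSpace.real_norm_sq_eq]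
        have := congrFun (congrFun hQ i) i
        simpa [Matrix.mul_apply, sq] using this
      nlinarith [norm_nonneg (WithLp.toLp 2 (fun k => Q k i) : EuclideanSpace ℝ m)]
    rw [h2, mul_one] at h1
    have h3 := pow_le_pow_left₀ (norm_nonneg _) h1 2
    rw [EuclideanSpace.real_norm_sq_eq] at h3
    refine le_trans (le_of_eq ?_) h3
    refine Finset.sum_congr rfl fun j _ => ?_
    simp [Matrix.mul_apply, Matrix.mulVec, dotProduct, mul_comm]
  calc _ ≤ ∑ _i : Fin d, opNorm A ^ 2 := Finset.sum_le_sum fun i _ => key i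
    _ = _ := by simp

/-- Two matrices of rank at most `r` have their columns in a common subspace of dimension at most
`2 r`; the columns of `Q` are an orthonormal basis of it. -/
theorem exists_orthonormal_columns {p r : ℕ} [DecidableEq n] {X₁ X₂ : Matrix (Fin p) n ℝ}
    (h₁ : X₁.rank ≤ r) (h₂ : X₂.rank ≤ r) :
    ∃ (d : ℕ) (Q : Matrix (Fin p) (Fin d) ℝ), d ≤ 2 * r ∧ Qᵀ * Q = 1 ∧
      Q * (Qᵀ * X₁) = X₁ ∧ Q * (Qᵀ * X₂) = X₂ := by
  let e := (WithLp.linearEquiv 2 ℝ (Fin p → ℝ)).symm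
  let S : Submodule ℝ (EuclideanSpace ℝ (Fin p)) :=
    (LinearMap.range X₁.mulVecLin ⊔ LinearMap.range X₂.mulVecLin).map e.toLinearMap
  let b := stdOrthonormalBasis ℝ S
  let Q : Matrix (Fin p) (Fin (Module.finrank ℝ S)) ℝ := Matrix.of fun i k => (b k).1 i
  -- Coordinate form of the orthonormal expansion: `Q Qᵀ` fixes every vector of `S`.
  have hS : ∀ v ∈ S, ∀ i, ∑ k, (b k).1 i * (∑ l, (b k).1 l * v l) = v i := by
    intro v hv i
    have h := congrArg (fun w : S => (w : EuclideanSpace ℝ (Fin p)) i) (b.sum_repr' ⟨v, hv⟩)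
    simp only [Submodule.coe_sum, Submodule.coe_smul, Submodule.coe_inner, WithLp.ofLp_sum,
      WithLp.ofLp_smul, Finset.sum_apply, Pi.smul_apply, smul_eq_mul, PiLp.inner_apply] at h
    rw [← h]
    refine Finset.sum_congr rfl fun k _ => ?_
    rw [mul_comm]
    congr 1
    refine Finset.sum_congr rfl fun l _ => ?_
    simp [mul_comm]
  have hcol : ∀ X : Matrix (Fin p) n ℝ,
      LinearMap.range X.mulVecLin ≤ LinearMap.range X₁.mulVecLin ⊔ LinearMap.range X₂.mulVecLin →
      Q * (Qᵀ * X) = X := by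
    intro X hX
    ext i j
    have hv : WithLp.toLp 2 (fun l => X l j) ∈ S := by
      refine ⟨fun l => X l j, hX ⟨Pi.single j 1, ?_⟩, rfl⟩
      simp
      rfl
    have := hS _ hv i
    simpa [Q, Matrix.mul_apply] using this
  refine ⟨Module.finrank ℝ S, Q, ?_, ?_, hcol X₁ le_sup_left, hcol X₂ le_sup_right⟩
  · have h3 : Module.finrank ℝ S ≤ X₁.rank + X₂.rank :=
      (Submodule.finrank_map_le _ _).trans (Submodule.finrank_add_le_finrank_add_finrank _ _)
    omega
  · ext i j
    have := (orthonormal_iff_ite.mp b.orthonormal) i j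
    rw [Submodule.coe_inner, PiLp.inner_apply] at this
    simp only [Matrix.mul_apply, Matrix.transpose_apply, Q, Matrix.of_apply, Matrix.one_apply]
    rw [← this]
    exact Finset.sum_congr rfl fun l _ => mul_comm _ _

end Frobenius

/-! ### Projections -/

section Projection

variable {p q κ n : ℕ}

theorem norm_sq_eq_frobNorm (Z : Param p q κ n) :
    ‖Z‖ ^ 2 = frobNorm (matX Z) ^ 2 + frobNorm (matG Z) ^ 2 := by
  rw [EuclideanSpace.real_norm_sq_eq, frobNorm_sq, frobNorm_sq, Fintype.sum_sum_type,
    Fintype.sum_prod_type, Fintype.sum_prod_type]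
  rfl

/-- The rank projection at most doubles the distance to a point of rank at most `r`, and the part
`τ G` of the error enters through its projection to a space of dimension at most `2 r`. -/
theorem IsRankProj.norm_sub_le {r : ℕ} {Y P Zs E G : Param p q κ n} {τ : ℝ} (hτ : 0 ≤ τ)
    (hP : IsRankProj r Y P) (hZs : (matX Zs).rank ≤ r) (hE : Y - Zs = E - τ • G) :
    ‖P - Zs‖ ≤ 2 * (‖E‖ + τ * (√(3 * r) * opNorm (matX G) + frobNorm (matG G))) := by
  obtain ⟨hG, hr, hbest⟩ := hP
  obtain ⟨d, Q, hd, hQ, hQP, hQs⟩ := exists_orthonormal_columns hr hZs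
  have hXE : matX Y - matX Zs = matX E - τ • matX G := by
    ext i c
    exact congrArg (fun W : Param p q κ n => W (Sum.inl (i, c))) hE
  have hGE : matG Y - matG Zs = matG E - τ • matG G := by
    ext i c
    exact congrArg (fun W : Param p q κ n => W (Sum.inr (i, c))) hE
  -- For columns in the range of `Q`, the distance to `matX Y` splits into a compressed part and a
  -- term independent of `X`. Optimality of `P` therefore survives compression by `Qᵀ`.
  have hproj : ∀ X : Matrix (Fin p) (Fin κ ⊕ Fin n) ℝ, Q * (Qᵀ * X) = X →
      frobNorm (X - matX Y) ^ 2 =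
        frobNorm (Qᵀ * (X - matX Y)) ^ 2 + frobNorm (Q * (Qᵀ * matX Y) - matX Y) ^ 2 := by
    intro X hX
    rw [frobNorm_sq_eq_add hQ]
    congr 3
    rw [Matrix.mul_sub, Matrix.mul_sub, hX]
    abel
  have h1 : frobNorm (Qᵀ * (matX P - matX Y)) ≤ frobNorm (Qᵀ * (matX Zs - matX Y)) := by
    refine le_of_sq_le_sq ?_ (frobNorm_nonneg _)
    have := pow_le_pow_left₀ (frobNorm_nonneg _) (hbest _ hZs) 2
    rw [hproj _ hQP, hproj _ hQs] at this
    linarith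
  have h2 : frobNorm (matX P - matX Zs) ≤ frobNorm (Qᵀ * (matX P - matX Zs)) := by
    refine le_of_sq_le_sq ?_ (frobNorm_nonneg _)
    rw [frobNorm_sq_eq_add hQ (matX P - matX Zs), Matrix.mul_sub, Matrix.mul_sub, hQP, hQs,
      sub_self, frobNorm_zero]
    simp
  have h3 : frobNorm (Qᵀ * (matX P - matX Zs))
      ≤ frobNorm (Qᵀ * (matX P - matX Y)) + frobNorm (Qᵀ * (matX Zs - matX Y)) := by
    rw [show matX P - matX Zs = (matX P - matX Y) - (matX Zs - matX Y) by abel, Matrix.mul_sub]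
    exact frobNorm_sub_le _ _
  have h4 : frobNorm (Qᵀ * (matX Zs - matX Y))
      ≤ frobNorm (matX E) + τ * (√(3 * r) * opNorm (matX G)) := by
    rw [show matX Zs - matX Y = (-1 : ℝ) • (matX Y - matX Zs) by simp, Matrix.mul_smul,
      frobNorm_smul, hXE, Matrix.mul_sub, Matrix.mul_smul]
    rw [abs_neg, abs_one, one_mul]
    refine (frobNorm_sub_le _ _).trans ?_
    rw [frobNorm_smul, abs_of_nonneg hτ]
    refine add_le_add (frobNorm_transpose_mul_le hQ _) (mul_le_mul_of_nonneg_left ?_ hτ)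
    refine (frobNorm_transpose_mul_le_opNorm hQ _).trans ?_
    -- The argument gives `2r`; the constant `3r` leaves slack.
    refine mul_le_mul_of_nonneg_right (Real.sqrt_le_sqrt ?_) (opNorm_nonneg _)
    have : (d : ℝ) ≤ 2 * r := by exact_mod_cast hd
    linarith [(Nat.cast_nonneg r : (0 : ℝ) ≤ r)]
  have h5 : frobNorm (matG P - matG Zs) ≤ frobNorm (matG E) + τ * frobNorm (matG G) := by
    rw [hG, hGE]
    refine (frobNorm_sub_le _ _).trans ?_
    rw [frobNorm_smul, abs_of_nonneg hτ]
  have hPZ := norm_sq_eq_frobNorm (P - Zs)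
  rw [show matX (P - Zs) = matX P - matX Zs from rfl,
    show matG (P - Zs) = matG P - matG Zs from rfl] at hPZ
  have hEE := norm_sq_eq_frobNorm E
  set α := τ * (√(3 * r) * opNorm (matX G))
  set β := τ * frobNorm (matG G)
  have hα : 0 ≤ α :=
    mul_nonneg hτ (mul_nonneg (Real.sqrt_nonneg _) (opNorm_nonneg _))
  have hβ : 0 ≤ β := mul_nonneg hτ (frobNorm_nonneg _)
  have hx := frobNorm_nonneg (matX E)
  have hg := frobNorm_nonneg (matG E)
  have hxe : frobNorm (matX E) ≤ ‖E‖ := by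
    refine le_of_sq_le_sq ?_ (norm_nonneg _); nlinarith
  have hge : frobNorm (matG E) ≤ ‖E‖ := by
    refine le_of_sq_le_sq ?_ (norm_nonneg _); nlinarith
  rw [mul_add τ]
  change _ ≤ 2 * (‖E‖ + (α + β))
  have hn := norm_nonneg E
  refine le_of_sq_le_sq ?_ (by positivity)
  have hX : frobNorm (matX P - matX Zs) ^ 2 ≤ (2 * (frobNorm (matX E) + α)) ^ 2 :=
    pow_le_pow_left₀ (frobNorm_nonneg _) (by linarith) 2
  have hGm : frobNorm (matG P - matG Zs) ^ 2 ≤ (2 * (frobNorm (matG E) + β)) ^ 2 :=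
    pow_le_pow_left₀ (frobNorm_nonneg _) (by linarith) 2
  -- With `x`, `g` the block norms of `E`, what remains is `(x + α)² + (g + β)² ≤ (‖E‖ + α + β)²`,
  -- which follows from `x² + g² = ‖E‖²` and `x, g ≤ ‖E‖`.
  rw [hPZ]
  nlinarith [mul_le_mul_of_nonneg_right hxe hα, mul_le_mul_of_nonneg_right hge hβ,
    mul_nonneg hα hβ]

/-- Variational inequality of the projection: moving from `P` slightly towards `W` stays in `Θ` and
cannot come closer to `Z`. -/
theorem IsNearest.inner_le_zero {Θ : Set (Param p q κ n)} (hΘ : Convex ℝ Θ)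
    {Z P : Param p q κ n} (h : IsNearest Θ Z P) {W : Param p q κ n} (hW : W ∈ Θ) :
    inner ℝ (Z - P) (W - P) ≤ 0 := by
  by_contra! hpos
  have key : ∀ t : ℝ, 0 < t → t ≤ 1 → 2 * inner ℝ (Z - P) (W - P) ≤ t * ‖W - P‖ ^ 2 := by
    intro t ht ht1
    have hmem : P + t • (W - P) ∈ Θ := hΘ.add_smul_sub_mem h.1 hW ⟨ht.le, ht1⟩
    have h1 := pow_le_pow_left₀ (norm_nonneg _) (h.2 _ hmem) 2
    rw [show P + t • (W - P) - Z = t • (W - P) - (Z - P) by abel, norm_sub_rev P Z,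
      norm_sub_sq_real (t • (W - P)), norm_smul, inner_smul_left, real_inner_comm, mul_pow, Real.norm_eq_abs,
      sq_abs] at h1
    simp only [conj_trivial] at h1
    refine le_of_mul_le_mul_left ?_ ht
    linarith
  have h1 := key 1 one_pos le_rfl
  have hd : 0 < ‖W - P‖ ^ 2 := by linarith
  -- This `t` turns the right side of `key` into the inner product `c` itself, so `2c ≤ c`. The case
  -- `t = 1` guarantees that it is admissible.
  have h2 := key (inner ℝ (Z - P) (W - P) / ‖W - P‖ ^ 2) (div_pos hpos hd)
    ((div_le_one hd).2 (by linarith))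
  rw [div_mul_cancel₀ _ hd.ne'] at h2
  linarith

/-- Adding the two variational inequalities gives firm nonexpansiveness; Cauchy–Schwarz finishes. -/
theorem IsNearest.norm_sub_le {Θ : Set (Param p q κ n)} (hΘ : Convex ℝ Θ)
    {Z P Z' P' : Param p q κ n} (h : IsNearest Θ Z P) (h' : IsNearest Θ Z' P') :
    ‖P - P'‖ ≤ ‖Z - Z'‖ := by
  have h1 := h.inner_le_zero hΘ h'.1
  have h2 := h'.inner_le_zero hΘ h.1
  have h3 : ‖P - P'‖ ^ 2 ≤ inner ℝ (Z - Z') (P - P') := by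
    rw [← real_inner_self_eq_norm_sq]
    simp only [inner_sub_left, inner_sub_right] at h1 h2 ⊢
    linarith
  have h4 := h3.trans (real_inner_le_norm _ _)
  rcases (norm_nonneg (P - P')).eq_or_lt with h0 | h0
  · rw [← h0]; exact norm_nonneg _
  · refine le_of_mul_le_mul_right ?_ h0
    nlinarith

/-- Expanding `‖τ∇f(Z) + (W - Z)‖²`, stationarity makes the cross term nonnegative, so `Z` is its
own projected gradient step. -/
theorem IsStationary.isGradientMapping_zero {f : Param p q κ n → ℝ} {Θ : Set (Param p q κ n)}
    {Z : Param p q κ n} (h : IsStationary f Θ Z) {τ : ℝ} (hτ : 0 ≤ τ) :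
    IsGradientMapping f Θ τ Z 0 := by
  refine ⟨Z, ⟨h.1, fun W hW => ?_⟩, by simp⟩
  refine le_of_sq_le_sq ?_ (norm_nonneg _)
  rw [show Z - (Z - τ • gradient f Z) = τ • gradient f Z by abel,
    show W - (Z - τ • gradient f Z) = τ • gradient f Z + (W - Z) by abel, norm_add_sq_real,
    inner_smul_left]
  simp only [conj_trivial]
  nlinarith [mul_nonneg hτ (h.2 W hW), sq_nonneg ‖W - Z‖]

end Projection

/-! ### Extreme eigenvalues and quadratic forms -/

section Eigenvalues

variable {m : Type*} [Fintype m] [DecidableEq m] {A : Matrix m m ℝ}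

/-- Subtracting `lambdaMin A` from `A` shifts the spectrum into the nonnegative half-line;
finiteness of the spectrum makes the infimum a genuine lower bound. -/
theorem lambdaMin_mul_le (hA : A.IsHermitian) (v : m → ℝ) :
    lambdaMin A * (v ⬝ᵥ v) ≤ v ⬝ᵥ A *ᵥ v := by
  have h : (A - algebraMap ℝ _ (lambdaMin A)).PosSemidef := by
    rw [posSemidef_iff_isHermitian_and_spectrum_nonneg]
    refine ⟨hA.sub ?_, ?_⟩
    · rw [Matrix.algebraMap_eq_diagonal]; exact Matrix.isHermitian_diagonal _
    · rw [← spectrum.sub_singleton_eq]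
      rintro x ⟨a, ha, b, hb, rfl⟩
      rw [Set.mem_singleton_iff] at hb
      subst hb
      exact sub_nonneg.2 (csInf_le A.finite_real_spectrum.bddBelow ha)
  have := h.dotProduct_mulVec_nonneg v
  rw [star_trivial, Matrix.sub_mulVec, dotProduct_sub, Algebra.algebraMap_eq_smul_one,
    Matrix.smul_mulVec, Matrix.one_mulVec, dotProduct_smul, smul_eq_mul] at this
  linarith

theorem le_lambdaMax_mul (hA : A.IsHermitian) (v : m → ℝ) :
    v ⬝ᵥ A *ᵥ v ≤ lambdaMax A * (v ⬝ᵥ v) := by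
  have h : (algebraMap ℝ _ (lambdaMax A) - A).PosSemidef := by
    rw [posSemidef_iff_isHermitian_and_spectrum_nonneg]
    refine ⟨Matrix.IsHermitian.sub ?_ hA, ?_⟩
    · rw [Matrix.algebraMap_eq_diagonal]; exact Matrix.isHermitian_diagonal _
    · rw [← spectrum.singleton_sub_eq]
      rintro x ⟨a, ha, b, hb, rfl⟩
      rw [Set.mem_singleton_iff] at ha
      subst ha
      exact sub_nonneg.2 (le_csSup A.finite_real_spectrum.bddAbove hb)
  have := h.dotProduct_mulVec_nonneg v
  rw [star_trivial, Matrix.sub_mulVec, dotProduct_sub, Algebra.algebraMap_eq_smul_one,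
    Matrix.smul_mulVec, Matrix.one_mulVec, dotProduct_smul, smul_eq_mul] at this
  linarith

end Eigenvalues

/-! ### The negative log-likelihood -/

section Likelihood

variable {κ n : ℕ} {h : ℝ → ℝ}

theorem scoreHess_symm (h : ℝ → ℝ) (y : Fin (κ + 1)) (a : EuclideanSpace ℝ (Fin κ))
    (i j : Fin κ) : scoreHess h y a i j = scoreHess h y a j i := by
  by_cases hij : i = j
  · rw [hij]
  · simp [scoreHess, hij, Ne.symm hij, mul_comm]

theorem scoreHess_isHermitian (h : ℝ → ℝ) (y : Fin (κ + 1)) (a : EuclideanSpace ℝ (Fin κ)) :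
    (scoreHess h y a).IsHermitian := by
  ext i j
  simpa using scoreHess_symm h y a j i

theorem one_le_partition (h0 : ∀ u, 0 ≤ h u) (a : EuclideanSpace ℝ (Fin κ)) :
    1 ≤ 1 + ∑ c, h (a c) :=
  le_add_of_nonneg_right (Finset.sum_nonneg fun _ _ => h0 _)

theorem nll_eq (h : ℝ → ℝ) (y : Fin (κ + 1)) (a : EuclideanSpace ℝ (Fin κ)) :
    nll h y a = -Real.log (predProb h a y) := by
  simp [nll]

theorem hasDerivAt_coord_line (a b : EuclideanSpace ℝ (Fin κ)) (j : Fin κ) (t : ℝ) :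
    HasDerivAt (fun t : ℝ => (a + t • b) j) (b j) t := by
  have := ((hasDerivAt_id t).mul_const (b j)).const_add (a j)
  simpa using this

theorem hasDerivAt_partition_line (hd : Differentiable ℝ h) (a b : EuclideanSpace ℝ (Fin κ))
    (t : ℝ) :
    HasDerivAt (fun t : ℝ => 1 + ∑ c, h ((a + t • b) c))
      (∑ c, deriv h ((a + t • b) c) * b c) t := by
  refine HasDerivAt.const_add _ (HasDerivAt.fun_sum fun c _ => ?_)
  exact (hd _).hasDerivAt.comp t (hasDerivAt_coord_line a b c t)

/-- The partition sum is at least `1`, so positivity of `h` matters only at the coordinate of a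
nonzero label. -/
theorem hasDerivAt_nll_line (hd : Differentiable ℝ h) (h0 : ∀ u, 0 ≤ h u) (y : Fin (κ + 1))
    (a b : EuclideanSpace ℝ (Fin κ)) (t : ℝ) (hpos : ∀ j : Fin κ, y = j.succ → 0 < h ((a + t • b) j)) :
    HasDerivAt (fun t : ℝ => nll h y (a + t • b))
      (∑ j, scoreGrad h y (a + t • b) j * b j) t := by
  simp only [nll_eq]
  have hS := hasDerivAt_partition_line hd a b t
  have hS1 : 0 < 1 + ∑ c, h ((a + t • b) c) := one_pos.trans_le (one_le_partition h0 _)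
  refine Fin.cases (fun _ => ?_) (fun k hpos => ?_) y hpos
  · have := ((hS.fun_inv hS1.ne').log (inv_pos.2 hS1).ne').neg
    simp only [predProb, Fin.cases_zero, one_div]
    refine this.congr_deriv ?_
    simp only [scoreGrad, (Fin.succ_ne_zero _).symm, if_false, zero_mul, sub_zero]
    simp only [div_mul_eq_mul_div]
    rw [← Finset.sum_div]
    field_simp
  · have hk := hpos k rfl
    have := ((((hd _).hasDerivAt.comp t (hasDerivAt_coord_line a b k t)).div hS
      hS1.ne').log (div_pos hk hS1).ne').neg
    simp only [predProb, Fin.cases_succ]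
    refine this.congr_deriv ?_
    simp only [scoreGrad, Fin.succ_inj, sub_mul, Finset.sum_sub_distrib, ite_mul, one_mul,
      zero_mul, Finset.sum_ite_eq, Finset.mem_univ, if_true, Pi.div_apply, Function.comp]
    simp only [div_mul_eq_mul_div]
    rw [← Finset.sum_div]
    field_simp
    ring

theorem hasDerivAt_scoreGrad_line (hh : ContDiff ℝ 2 h) (h0 : ∀ u, 0 ≤ h u) (y : Fin (κ + 1))
    (a b : EuclideanSpace ℝ (Fin κ)) (t : ℝ)
    (hpos : ∀ j : Fin κ, y = j.succ → 0 < h ((a + t • b) j)) (j : Fin κ) :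
    HasDerivAt (fun t : ℝ => scoreGrad h y (a + t • b) j)
      (∑ i, b i * scoreHess h y (a + t • b) i j) t := by
  have hd : Differentiable ℝ h := hh.differentiable (by norm_num)
  have hd2 : Differentiable ℝ (deriv h) :=
    ((contDiff_succ_iff_deriv (n := 1)).1 (by simpa [one_add_one_eq_two] using hh)).2.2.differentiable
      (by norm_num)
  have hS := hasDerivAt_partition_line hd a b t
  have hS1 := one_le_partition h0 (a + t • b)
  have hc := hasDerivAt_coord_line a b j t
  have h1 := ((hd2 _).hasDerivAt.comp t hc).div hS (by positivity)
  have hsum : ∑ i, b i * scoreHess h y (a + t • b) i j =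
      deriv (deriv h) ((a + t • b) j) * b j / (1 + ∑ c, h ((a + t • b) c))
      - deriv h ((a + t • b) j) * (∑ c, deriv h ((a + t • b) c) * b c)
        / (1 + ∑ c, h ((a + t • b) c)) ^ 2
      - (if y = j.succ then 1 else 0) * ((deriv (deriv h) ((a + t • b) j) / h ((a + t • b) j)
        - deriv h ((a + t • b) j) ^ 2 / h ((a + t • b) j) ^ 2) * b j) := by
    simp only [scoreHess, Matrix.of_apply, mul_sub, Finset.sum_sub_distrib]
    congr 1
    · congr 1
      · rw [Finset.sum_eq_single j]
        · simp; ring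
        · intro i _ hi; simp [hi]
        · simp
      · rw [Finset.mul_sum, Finset.sum_div]
        exact Finset.sum_congr rfl fun i _ => by ring
    · rw [← Finset.sum_sub_distrib, Finset.sum_eq_single j]
      · by_cases hy : y = j.succ
        · simp [hy]; ring
        · simp [hy]
      · intro i _ hi; simp [hi]
      · simp
  rw [hsum]
  by_cases hy : y = j.succ
  · have hk := hpos j hy
    have h2 := ((hd2 _).hasDerivAt.comp t hc).div ((hd _).hasDerivAt.comp t hc)
      (by simp only [Function.comp]; positivity)
    simp only [scoreGrad, hy, if_true, one_mul]
    refine (h1.sub h2).congr_deriv ?_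
    simp only [Function.comp]
    field_simp
  · simp only [scoreGrad, hy, if_false, zero_mul, sub_zero]
    refine h1.congr_deriv ?_
    simp only [Function.comp]
    field_simp

variable {y : Fin n → Fin (κ + 1)} {M αm αp : ℝ}

/-- A score function with bounded stiffness and positive information does not vanish at the
activations in the closed ball that occur in the likelihood. -/
theorem InformationBounds.score_pos (hα : InformationBounds h y M αm αp) (hM : 0 < M) {s : Fin n}
    {j : Fin κ} (hy : y s = j.succ) {u : ℝ} (hu : |u| ≤ M) : 0 < h u := by
  have h0 := hα.nonneg
  have hd : Differentiable ℝ h := hα.contDiff.differentiable (by norm_num)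
  have hdc : Continuous (deriv h) := hα.contDiff.continuous_deriv (by norm_num)
  obtain ⟨γ, -, hγ⟩ := hα.gamma
  obtain ⟨K, hK⟩ := (isCompact_Icc (a := -M) (b := M)).exists_bound_of_continuousOn hdc.continuousOn
  -- Bounded stiffness bounds `h'/h - h'/S`, and `h'/S` is bounded by `K`, so `h'/h` is bounded. At
  -- a zero of `h`, which is a minimum, `h'` vanishes.
  have hlog : ∀ v : ℝ, |v| < M → |deriv h v| ≤ (γ + K) * h v := by
    intro v hv
    rcases (h0 v).eq_or_lt with hz | hp
    · have : deriv h v = 0 := IsLocalMin.deriv_eq_zero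
        (Filter.Eventually.of_forall fun w => hz ▸ h0 w)
      simp [this, ← hz]
    · have h1 := hγ.1 ⟨EuclideanSpace.single j v, by simpa using hv, s, rfl⟩
      have h2 := (norm_le_pi_norm (scoreGrad h (y s) (EuclideanSpace.single j v)) j).trans h1
      have hS := one_le_partition h0 (EuclideanSpace.single j v)
      have hKv := hK v (abs_le.1 hv.le)
      simp only [scoreGrad, hy, if_true, one_mul, Real.norm_eq_abs, PiLp.single_apply]
        at h2 hS hKv
      rw [abs_sub_comm] at h2
      have h3 := (abs_sub_abs_le_abs_sub _ _).trans h2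
      rw [abs_div, abs_div, abs_of_pos hp, abs_of_pos (one_pos.trans_le hS)] at h3
      have h4 : |deriv h v| / (1 + ∑ c, h (if c = j then v else 0)) ≤ K :=
        (div_le_self (abs_nonneg _) hS).trans hKv
      rw [← div_le_iff₀ hp]
      linarith
  set C := γ + K
  by_contra! hneg
  have hz : h u = 0 := le_antisymm hneg (h0 u)
  -- Grönwall argument: `|h'| ≤ C h` makes `exp (C v) * h v` increasing and `exp (-C v) * h v`
  -- decreasing, so one zero spreads to the whole interval. Then `scoreHess` vanishes at the origin,
  -- against `0 < αm`.
  have hexp : ∀ (c v : ℝ), HasDerivAt (fun v => Real.exp (c * v) * h v)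
      (Real.exp (c * v) * (c * h v + deriv h v)) v := by
    intro c v
    have h1 := ((hasDerivAt_id v).const_mul c).exp.mul (hd v).hasDerivAt
    refine h1.congr_deriv ?_
    simp; ring
  have hmono : MonotoneOn (fun v => Real.exp (C * v) * h v) (Set.Icc (-M) M) := by
    refine monotoneOn_of_deriv_nonneg (convex_Icc _ _)
      (fun v _ => (hexp C v).continuousAt.continuousWithinAt)
      (fun v _ => (hexp C v).differentiableAt.differentiableWithinAt) fun v hv => ?_
    rw [interior_Icc] at hv
    rw [(hexp C v).deriv]
    have := (abs_le.1 (hlog v (abs_lt.2 hv))).1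
    exact mul_nonneg (Real.exp_nonneg _) (by linarith)
  have hanti : AntitoneOn (fun v => Real.exp (-C * v) * h v) (Set.Icc (-M) M) := by
    refine antitoneOn_of_deriv_nonpos (convex_Icc _ _)
      (fun v _ => (hexp (-C) v).continuousAt.continuousWithinAt)
      (fun v _ => (hexp (-C) v).differentiableAt.differentiableWithinAt) fun v hv => ?_
    rw [interior_Icc] at hv
    rw [(hexp (-C) v).deriv]
    have := (abs_le.1 (hlog v (abs_lt.2 hv))).2
    exact mul_nonpos_of_nonneg_of_nonpos (Real.exp_nonneg _) (by linarith)
  have hzero : ∀ v ∈ Set.Icc (-M) M, h v = 0 := by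
    intro v hv
    refine le_antisymm ?_ (h0 v)
    rcases le_total v u with hvu | hvu
    · have := hmono hv (abs_le.1 hu) hvu
      simp only [hz, mul_zero] at this
      exact nonpos_of_mul_nonpos_right this (Real.exp_pos _)
    · have := hanti (abs_le.1 hu) hv hvu
      simp only [hz, mul_zero] at this
      exact nonpos_of_mul_nonpos_right this (Real.exp_pos _)
  have hev : h =ᶠ[nhds 0] fun _ => 0 :=
    Filter.eventually_of_mem (Icc_mem_nhds (neg_lt_zero.2 hM) hM) hzero
  have hd0 : deriv h 0 = 0 := by rw [hev.deriv_eq]; simp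
  have hdd0 : deriv (deriv h) 0 = 0 := by rw [hev.deriv.deriv_eq]; simp
  have hH : scoreHess h (y s) 0 = 0 := by
    ext i k
    simp [scoreHess, hd0, hdd0]
  have hle := hα.alpham.1 ⟨0, by simpa using hM, s, rfl⟩
  have hq := lambdaMin_mul_le (scoreHess_isHermitian h (y s) 0) (Pi.single j 1)
  rw [hH] at hq hle
  simp at hq
  linarith [hα.alpham_pos]

theorem InformationBounds.coord_pos (hα : InformationBounds h y M αm αp) (hM : 0 < M) {s : Fin n}
    {a : EuclideanSpace ℝ (Fin κ)} (ha : ‖a‖ ≤ M) (j : Fin κ) (hy : y s = j.succ) :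
    0 < h (a j) :=
  hα.score_pos hM hy ((PiLp.norm_apply_le a j).trans ha)

/-- The eigenvalue bounds extend to the closed ball by continuity. -/
theorem InformationBounds.quadratic_bounds (hα : InformationBounds h y M αm αp) (hM : 0 < M)
    (s : Fin n) {a : EuclideanSpace ℝ (Fin κ)} (ha : ‖a‖ ≤ M) (v : Fin κ → ℝ) :
    αm * (v ⬝ᵥ v) ≤ v ⬝ᵥ scoreHess h (y s) a *ᵥ v ∧
      v ⬝ᵥ scoreHess h (y s) a *ᵥ v ≤ αp * (v ⬝ᵥ v) := by
  have hv : 0 ≤ v ⬝ᵥ v := Finset.sum_nonneg fun i _ => mul_self_nonneg _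
  have hopen : ∀ b : EuclideanSpace ℝ (Fin κ), ‖b‖ < M →
      αm * (v ⬝ᵥ v) ≤ v ⬝ᵥ scoreHess h (y s) b *ᵥ v ∧
      v ⬝ᵥ scoreHess h (y s) b *ᵥ v ≤ αp * (v ⬝ᵥ v) := fun b hb =>
    ⟨(mul_le_mul_of_nonneg_right (hα.alpham.1 ⟨b, hb, s, rfl⟩) hv).trans
      (lambdaMin_mul_le (scoreHess_isHermitian h _ b) v),
    (le_lambdaMax_mul (scoreHess_isHermitian h _ b) v).trans
      (mul_le_mul_of_nonneg_right (hα.alphap.1 ⟨b, hb, s, rfl⟩) hv)⟩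
  -- Continuity along the ray through `a` suffices, since `t • a` lies in the open ball for `0 < t <
  -- 1`. The entry divided by `h` is continuous at `t = 1` because `h` is positive there.
  have hcont : ContinuousAt (fun t : ℝ => v ⬝ᵥ scoreHess h (y s) (t • a) *ᵥ v) 1 := by
    have hc : Continuous h := hα.contDiff.continuous
    have hdc : Continuous (deriv h) := hα.contDiff.continuous_deriv (by norm_num)
    have hddc : Continuous (deriv (deriv h)) :=
      ((contDiff_succ_iff_deriv (n := 1)).1
        (by simpa [one_add_one_eq_two] using hα.contDiff)).2.2.continuous_deriv le_rfl
    simp only [dotProduct, Matrix.mulVec, scoreHess, Matrix.of_apply, PiLp.smul_apply, smul_eq_mul]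
    have hS : ∀ t : ℝ, (1 + ∑ c, h (t * a c)) ≠ 0 := fun t =>
      (lt_of_lt_of_le one_pos (one_le_partition hα.nonneg (t • a))).ne'
    have hS2 : ∀ t : ℝ, (1 + ∑ c, h (t * a c)) ^ 2 ≠ 0 := fun t => pow_ne_zero _ (hS t)
    refine tendsto_finsetSum _ fun i _ => Filter.Tendsto.mul tendsto_const_nhds
      (tendsto_finsetSum _ fun j _ => Filter.Tendsto.mul ?_ tendsto_const_nhds)
    refine Filter.Tendsto.sub (Continuous.continuousAt ?_) ?_
    · refine Continuous.sub (Continuous.div (by fun_prop) (by fun_prop) hS)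
        (Continuous.div (by fun_prop) (by fun_prop) hS2)
    · by_cases hy : y s = i.succ ∧ i = j
      · have hp := hα.coord_pos hM ha i hy.1
        rw [hy.2] at hp
        have hp1 : h (1 * a j) ≠ 0 := by rw [one_mul]; exact hp.ne'
        have hp2 : h (1 * a j) ^ 2 ≠ 0 := pow_ne_zero _ hp1
        refine Filter.Tendsto.mul tendsto_const_nhds (ContinuousAt.sub
          (ContinuousAt.div (Continuous.continuousAt (by fun_prop))
            (Continuous.continuousAt (by fun_prop)) hp1)
          (ContinuousAt.div (Continuous.continuousAt (by fun_prop))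
            (Continuous.continuousAt (by fun_prop)) hp2))
      · simp only [hy, if_false, zero_mul]
        exact tendsto_const_nhds
  have hlim := hcont.tendsto.mono_left (nhdsWithin_le_nhds (s := Set.Iio 1))
  rw [one_smul] at hlim
  have hmem : ∀ᶠ t : ℝ in nhdsWithin 1 (Set.Iio 1), ‖t • a‖ < M := by
    filter_upwards [Ioo_mem_nhdsLT (zero_lt_one (α := ℝ))] with t ht
    rw [norm_smul, Real.norm_eq_abs, abs_of_pos ht.1]
    rcases (norm_nonneg a).eq_or_lt with h0 | h0
    · rw [← h0]; simpa using hM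
    · nlinarith [ht.2]
  exact ⟨ge_of_tendsto hlim (hmem.mono fun t ht => (hopen _ ht).1),
    le_of_tendsto hlim (hmem.mono fun t ht => (hopen _ ht).2)⟩

end Likelihood

/-- A symmetric bilinear form bounded by `η ‖v‖²` on the diagonal is bounded by `η ‖v‖ ‖w‖`. -/
theorem bilin_le_of_diagonal_le {E : Type*} [NormedAddCommGroup E] [InnerProductSpace ℝ E]
    {T : E →ₗ[ℝ] E →ₗ[ℝ] ℝ} (hsymm : ∀ v w, T v w = T w v) {η : ℝ}
    (hη : ∀ v, |T v v| ≤ η * ‖v‖ ^ 2) (v w : E) : T v w ≤ η * (‖v‖ * ‖w‖) := by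
  rcases (norm_nonneg v).eq_or_lt with hv | hv
  · rw [norm_eq_zero.1 hv.symm]; simp
  rcases (norm_nonneg w).eq_or_lt with hw | hw
  · rw [norm_eq_zero.1 hw.symm]; simp
  -- Polarization with both vectors rescaled to the common norm `‖v‖ ‖w‖`, so that the parallelogram
  -- law yields the product rather than a mean of squares.
  have h1 := (abs_le.1 (hη (‖w‖ • v + ‖v‖ • w))).2
  have h2 := (abs_le.1 (hη (‖w‖ • v - ‖v‖ • w))).1
  have h3 := parallelogram_law_with_norm ℝ (‖w‖ • v) (‖v‖ • w)
  simp only [map_add, map_sub, map_smul, LinearMap.add_apply, LinearMap.sub_apply,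
    LinearMap.smul_apply, smul_eq_mul, hsymm w v] at h1 h2
  simp only [norm_smul, norm_norm] at h3
  have h5 := congrArg (η * ·) h3
  simp only [mul_add] at h5
  have h4 : (‖v‖ * ‖w‖) * T v w ≤ (‖v‖ * ‖w‖) * (η * (‖v‖ * ‖w‖)) := by linarith
  exact le_of_mul_le_mul_left h4 (mul_pos hv hw)

/-! ### Derivatives and curvature of the objective -/

section Objective

variable {p q κ n : ℕ} {h : ℝ → ℝ} {ξ ν : ℝ} {Xdata : Matrix (Fin p) (Fin n) ℝ}
  {Xaux : Matrix (Fin q) (Fin n) ℝ} {y : Fin n → Fin (κ + 1)} {M αm αp δm δp : ℝ}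

theorem activation_apply (Xdata : Matrix (Fin p) (Fin n) ℝ) (Xaux : Matrix (Fin q) (Fin n) ℝ)
    (Z : Param p q κ n) (s : Fin n) (j : Fin κ) :
    activation Xdata Xaux Z s j =
      ∑ i, Z (Sum.inl (i, Sum.inl j)) * Xdata i s + ∑ k, Z (Sum.inr (k, j)) * Xaux k s := by
  simp [activation, Matrix.mulVec, dotProduct, matA, matG]

theorem activation_add (Z W : Param p q κ n) (s : Fin n) :
    activation Xdata Xaux (Z + W) s = activation Xdata Xaux Z s + activation Xdata Xaux W s := by
  ext j
  simp only [activation_apply, PiLp.add_apply, add_mul, Finset.sum_add_distrib]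
  ring

theorem activation_smul (c : ℝ) (Z : Param p q κ n) (s : Fin n) :
    activation Xdata Xaux (c • Z) s = c • activation Xdata Xaux Z s := by
  ext j
  simp only [activation_apply, PiLp.smul_apply, smul_eq_mul, mul_assoc, ← Finset.mul_sum]
  ring

theorem activation_sub (Z W : Param p q κ n) (s : Fin n) :
    activation Xdata Xaux (Z - W) s = activation Xdata Xaux Z s - activation Xdata Xaux W s := by
  rw [eq_sub_iff_add_eq, ← activation_add, sub_add_cancel]

/-- Activations are linear in the parameter, so this is convexity of the closed ball; it makes the
mean value theorem available between two admissible points. -/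
theorem BoundedActivation.line {Z W : Param p q κ n} (hZ : BoundedActivation Xdata Xaux M Z)
    (hW : BoundedActivation Xdata Xaux M W) {t : ℝ} (ht : t ∈ Set.Icc (0 : ℝ) 1) :
    BoundedActivation Xdata Xaux M (Z + t • (W - Z)) := by
  intro s
  rw [activation_add, activation_smul, activation_sub]
  have := (convex_closedBall (0 : EuclideanSpace ℝ (Fin κ)) M).add_smul_sub_mem
    (mem_closedBall_zero_iff.2 (hZ s)) (mem_closedBall_zero_iff.2 (hW s)) ht
  exact mem_closedBall_zero_iff.1 this

theorem norm_sq_eq_blocks (Z : Param p q κ n) :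
    ‖Z‖ ^ 2 = (∑ i, ∑ j, matA Z i j ^ 2) + (∑ i, ∑ s, matB Z i s ^ 2)
      + ∑ k, ∑ j, matG Z k j ^ 2 := by
  rw [norm_sq_eq_frobNorm, frobNorm_sq, frobNorm_sq]
  simp only [Fintype.sum_sum_type, Finset.sum_add_distrib]
  rfl

/-- The eigenvalue bounds of the covariance control the activations. -/
theorem CovarianceBounds.sum_activation_sq (hδ : CovarianceBounds Xdata Xaux δm δp)
    (Z : Param p q κ n) :
    n * δm * ((∑ i, ∑ j, matA Z i j ^ 2) + ∑ k, ∑ j, matG Z k j ^ 2)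
        ≤ ∑ s, ∑ j, activation Xdata Xaux Z s j ^ 2 ∧
      ∑ s, ∑ j, activation Xdata Xaux Z s j ^ 2
        ≤ n * δp * ((∑ i, ∑ j, matA Z i j ^ 2) + ∑ k, ∑ j, matG Z k j ^ 2) := by
  rcases Nat.eq_zero_or_pos n with hn | hn
  · subst hn; simp
  have hn' : (0 : ℝ) < n := Nat.cast_pos.2 hn
  -- `v j` is the `j`-th column of `A` stacked on `Γ`. The `j`-th activations over all samples form
  -- `Φᵀ v_j`, whose squared norm is `n` times the covariance form at `v_j`.
  let v : Fin κ → Fin p ⊕ Fin q → ℝ := fun j => Sum.elim (fun i => matA Z i j) fun k => matG Z k j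
  have hvv : ∑ j, v j ⬝ᵥ v j = (∑ i, ∑ j, matA Z i j ^ 2) + ∑ k, ∑ j, matG Z k j ^ 2 := by
    rw [Finset.sum_comm (s := Finset.univ (α := Fin p)),
      Finset.sum_comm (s := Finset.univ (α := Fin q)), ← Finset.sum_add_distrib]
    exact Finset.sum_congr rfl fun j _ => by simp [v, dotProduct, sq]
  have hherm : (covariance Xdata Xaux).IsHermitian := by
    rw [Matrix.IsHermitian, covariance, Matrix.conjTranspose_eq_transpose_of_trivial,
      Matrix.transpose_smul, Matrix.transpose_mul, Matrix.transpose_transpose]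
  have hact : ∀ s j, activation Xdata Xaux Z s j =
      ((Matrix.fromRows Xdata Xaux)ᵀ *ᵥ v j) s := by
    intro s j
    rw [activation_apply]
    simp [v, Matrix.mulVec, dotProduct, matA, matG, mul_comm]
  have hquad : ∀ j, (n : ℝ) * (v j ⬝ᵥ covariance Xdata Xaux *ᵥ v j) =
      ∑ s, activation Xdata Xaux Z s j ^ 2 := by
    intro j
    rw [covariance, Matrix.smul_mulVec, dotProduct_smul, smul_eq_mul,
      mul_inv_cancel_left₀ hn'.ne', ← Matrix.mulVec_mulVec, Matrix.dotProduct_mulVec,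
      ← Matrix.mulVec_transpose]
    exact Finset.sum_congr rfl fun s _ => by rw [hact, sq]
  have hsq : ∀ j, 0 ≤ v j ⬝ᵥ v j := fun j => Finset.sum_nonneg fun i _ => mul_self_nonneg _
  rw [← hvv, Finset.sum_comm (s := Finset.univ (α := Fin n)), Finset.mul_sum, Finset.mul_sum]
  constructor
  · refine Finset.sum_le_sum fun j _ => ?_
    rw [← hquad, mul_assoc]
    exact mul_le_mul_of_nonneg_left ((mul_le_mul_of_nonneg_right hδ.2.2.1 (hsq j)).trans
      (lambdaMin_mul_le hherm _)) hn'.le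
  · refine Finset.sum_le_sum fun j _ => ?_
    rw [← hquad, mul_assoc]
    exact mul_le_mul_of_nonneg_left ((le_lambdaMax_mul hherm _).trans
      (mul_le_mul_of_nonneg_right hδ.2.2.2 (hsq j))) hn'.le

/-- The derivative of the objective at `Z` in the direction `W`. -/
noncomputable def objectiveDeriv (h : ℝ → ℝ) (ξ ν : ℝ) (Xdata : Matrix (Fin p) (Fin n) ℝ)
    (Xaux : Matrix (Fin q) (Fin n) ℝ) (y : Fin n → Fin (κ + 1)) (Z W : Param p q κ n) : ℝ :=
  (∑ s, ∑ j, scoreGrad h (y s) (activation Xdata Xaux Z s) j * activation Xdata Xaux W s j)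
    + 2 * ξ * (∑ i, ∑ s, (matB Z i s - Xdata i s) * matB W i s)
    + 2 * ν * ((∑ i, ∑ j, matA Z i j * matA W i j) + ∑ k, ∑ j, matG Z k j * matG W k j)

/-- The second derivative of the objective at `Z`, as a bilinear form. -/
noncomputable def objectiveHess (h : ℝ → ℝ) (ξ ν : ℝ) (Xdata : Matrix (Fin p) (Fin n) ℝ)
    (Xaux : Matrix (Fin q) (Fin n) ℝ) (y : Fin n → Fin (κ + 1)) (Z : Param p q κ n) :
    Param p q κ n →ₗ[ℝ] Param p q κ n →ₗ[ℝ] ℝ :=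
  LinearMap.mk₂ ℝ (fun D W =>
    (∑ s, ∑ j, (∑ i, activation Xdata Xaux D s i *
        scoreHess h (y s) (activation Xdata Xaux Z s) i j) * activation Xdata Xaux W s j)
      + 2 * ξ * (∑ i, ∑ s, matB D i s * matB W i s)
      + 2 * ν * ((∑ i, ∑ j, matA D i j * matA W i j) + ∑ k, ∑ j, matG D k j * matG W k j))
    (fun D D' W => by
      simp only [activation_add, matA, matB, matG, Matrix.of_apply, PiLp.add_apply, add_mul,
        Finset.sum_add_distrib, mul_add]
      ring)
    (fun c D W => by
      simp only [activation_smul, matA, matB, matG, Matrix.of_apply, PiLp.smul_apply, smul_eq_mul,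
        mul_assoc, ← Finset.mul_sum]
      ring)
    (fun D W W' => by
      simp only [activation_add, matA, matB, matG, Matrix.of_apply, PiLp.add_apply, mul_add,
        Finset.sum_add_distrib]
      ring)
    (fun c D W => by
      simp only [activation_smul, matA, matB, matG, Matrix.of_apply, PiLp.smul_apply, smul_eq_mul,
        mul_left_comm _ c, ← Finset.mul_sum]
      ring)

theorem objectiveHess_symm (Z D W : Param p q κ n) :
    objectiveHess h ξ ν Xdata Xaux y Z D W = objectiveHess h ξ ν Xdata Xaux y Z W D := by
  simp only [objectiveHess, LinearMap.mk₂_apply]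
  congr 1
  · congr 1
    · refine Finset.sum_congr rfl fun s _ => ?_
      simp only [Finset.sum_mul]
      rw [Finset.sum_comm]
      refine Finset.sum_congr rfl fun i _ => Finset.sum_congr rfl fun j _ => ?_
      rw [scoreHess_symm h (y s) _ i j]
      ring
    · simp only [mul_comm]
  · simp only [mul_comm]

theorem hasDerivAt_objective_line (hα : InformationBounds h y M αm αp) (hM : 0 < M)
    {Z : Param p q κ n} (W : Param p q κ n) {t : ℝ}
    (hZ : BoundedActivation Xdata Xaux M (Z + t • W)) :
    HasDerivAt (fun t : ℝ => objective h ξ ν Xdata Xaux y (Z + t • W))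
      (objectiveDeriv h ξ ν Xdata Xaux y (Z + t • W) W) t := by
  have hd : Differentiable ℝ h := hα.contDiff.differentiable (by norm_num)
  have hcoord : ∀ i, HasDerivAt (fun t : ℝ => Z i + t * W i) (W i) t := fun i => by
    simpa using ((hasDerivAt_id t).mul_const (W i)).const_add (Z i)
  have hsq : ∀ i, HasDerivAt (fun t : ℝ => (Z i + t * W i) ^ 2)
      (2 * ((Z i + t * W i) * W i)) t := fun i =>
    ((hcoord i).fun_pow 2).congr_deriv (by norm_num; ring)
  have hB : ∀ i s, HasDerivAt
      (fun t : ℝ => (Xdata i s - (Z (Sum.inl (i, Sum.inr s)) + t * W (Sum.inl (i, Sum.inr s)))) ^ 2)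
      (2 * ((Z (Sum.inl (i, Sum.inr s)) + t * W (Sum.inl (i, Sum.inr s)) - Xdata i s)
        * W (Sum.inl (i, Sum.inr s)))) t := fun i s =>
    (((hcoord _).const_sub (Xdata i s)).fun_pow 2).congr_deriv (by norm_num; ring)
  have hnll : ∀ s, HasDerivAt
      (fun t : ℝ => nll h (y s) (activation Xdata Xaux Z s + t • activation Xdata Xaux W s))
      (∑ j, scoreGrad h (y s) (activation Xdata Xaux Z s + t • activation Xdata Xaux W s) j
        * activation Xdata Xaux W s j) t := fun s =>
    hasDerivAt_nll_line hd hα.nonneg _ _ _ _ fun j hj => by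
      have := hα.coord_pos hM (hZ s) j hj
      rwa [activation_add, activation_smul] at this
  simp only [objective, objectiveDeriv, frobNorm_sq, activation_add, activation_smul, matA, matB,
    matG, Matrix.sub_apply, Matrix.of_apply, PiLp.add_apply, PiLp.smul_apply, smul_eq_mul]
  refine (((HasDerivAt.fun_sum fun s _ => hnll s).add ((HasDerivAt.fun_sum fun i _ =>
    HasDerivAt.fun_sum fun s _ => hB i s).const_mul ξ)).add
    (((HasDerivAt.fun_sum fun i _ => HasDerivAt.fun_sum fun j _ => hsq (Sum.inl (i, Sum.inl j))).add
      (HasDerivAt.fun_sum fun k _ => HasDerivAt.fun_sum fun j _ =>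
        hsq (Sum.inr (k, j)))).const_mul ν)).congr_deriv ?_
  simp only [← Finset.mul_sum]
  ring

theorem hasDerivAt_objectiveDeriv_line (hα : InformationBounds h y M αm αp) (hM : 0 < M)
    {Z : Param p q κ n} (D W : Param p q κ n) {t : ℝ}
    (hZ : BoundedActivation Xdata Xaux M (Z + t • D)) :
    HasDerivAt (fun t : ℝ => objectiveDeriv h ξ ν Xdata Xaux y (Z + t • D) W)
      (objectiveHess h ξ ν Xdata Xaux y (Z + t • D) D W) t := by
  have hcoord : ∀ i (c : ℝ), HasDerivAt (fun t : ℝ => (Z i + t * D i) * c) (D i * c) t :=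
    fun i c => by
      simpa using (((hasDerivAt_id t).mul_const (D i)).const_add (Z i)).mul_const c
  have hB : ∀ i (x c : ℝ), HasDerivAt (fun t : ℝ => (Z i + t * D i - x) * c) (D i * c) t :=
    fun i x c => by
      simpa using ((((hasDerivAt_id t).mul_const (D i)).const_add (Z i)).sub_const x).mul_const c
  have hsc : ∀ s j, HasDerivAt
      (fun t : ℝ =>
        scoreGrad h (y s) (activation Xdata Xaux Z s + t • activation Xdata Xaux D s) j)
      (∑ i, activation Xdata Xaux D s i *
        scoreHess h (y s) (activation Xdata Xaux Z s + t • activation Xdata Xaux D s) i j) t :=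
    fun s j => hasDerivAt_scoreGrad_line hα.contDiff hα.nonneg _ _ _ _ (fun j hj => by
      have := hα.coord_pos hM (hZ s) j hj
      rwa [activation_add, activation_smul] at this) j
  simp only [objectiveDeriv, objectiveHess, LinearMap.mk₂_apply, activation_add, activation_smul,
    matA, matB, matG, Matrix.of_apply, PiLp.add_apply, PiLp.smul_apply, smul_eq_mul]
  refine ((HasDerivAt.fun_sum fun s _ => HasDerivAt.fun_sum fun j _ =>
      (hsc s j).mul_const (activation Xdata Xaux W s j)).add ((HasDerivAt.fun_sum fun i _ =>
      HasDerivAt.fun_sum fun s _ => hB (Sum.inl (i, Sum.inr s)) (Xdata i s)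
        (W (Sum.inl (i, Sum.inr s)))).const_mul (2 * ξ))).add
    (((HasDerivAt.fun_sum fun i _ => HasDerivAt.fun_sum fun j _ =>
      hcoord (Sum.inl (i, Sum.inl j)) (W (Sum.inl (i, Sum.inl j)))).add
      (HasDerivAt.fun_sum fun k _ => HasDerivAt.fun_sum fun j _ =>
        hcoord (Sum.inr (k, j)) (W (Sum.inr (k, j))))).const_mul (2 * ν))

/-- Line derivatives alone do not identify `gradient`, which takes a default value where Fréchet
differentiability fails. -/
theorem differentiableAt_objective (hα : InformationBounds h y M αm αp) (hM : 0 < M)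
    {Z : Param p q κ n} (hZ : BoundedActivation Xdata Xaux M Z) :
    DifferentiableAt ℝ (objective h ξ ν Xdata Xaux y) Z := by
  have hd : Differentiable ℝ h := hα.contDiff.differentiable (by norm_num)
  have hact : ∀ s j, Differentiable ℝ fun Z : Param p q κ n => activation Xdata Xaux Z s j := by
    intro s j
    simp only [activation_apply]
    fun_prop
  have hS : ∀ s, DifferentiableAt ℝ
      (fun Z : Param p q κ n => 1 + ∑ c, h (activation Xdata Xaux Z s c)) Z := fun s =>
    ((DifferentiableAt.fun_sum fun c _ => (hd _).comp Z (hact s c Z))).const_add 1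
  have hS1 : ∀ s, 0 < 1 + ∑ c, h (activation Xdata Xaux Z s c) := fun s =>
    one_pos.trans_le (one_le_partition hα.nonneg _)
  have hnll : ∀ s, DifferentiableAt ℝ
      (fun Z : Param p q κ n => nll h (y s) (activation Xdata Xaux Z s)) Z := by
    intro s
    simp only [nll_eq]
    refine DifferentiableAt.fun_neg ?_
    have hp : ∀ j, y s = j.succ → 0 < h (activation Xdata Xaux Z s j) := fun j hj =>
      hα.coord_pos hM (hZ s) j hj
    refine Fin.cases (fun _ => ?_) (fun k hp => ?_) (y s) hp
    · simp only [predProb, Fin.cases_zero, one_div]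
      exact ((hS s).fun_inv (hS1 s).ne').log (inv_pos.2 (hS1 s)).ne'
    · simp only [predProb, Fin.cases_succ, div_eq_mul_inv]
      have hk : DifferentiableAt ℝ
          (fun Z : Param p q κ n => h (activation Xdata Xaux Z s k)) Z :=
        (hd _).comp Z (hact s k Z)
      exact (hk.fun_mul ((hS s).fun_inv (hS1 s).ne')).log
        (mul_pos (hp k rfl) (inv_pos.2 (hS1 s))).ne'
  unfold objective
  refine ((DifferentiableAt.fun_sum fun s _ => hnll s).add ?_).add ?_
  · simp only [frobNorm_sq, matB, Matrix.sub_apply, Matrix.of_apply]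
    fun_prop
  · simp only [frobNorm_sq, matA, matG, Matrix.of_apply]
    fun_prop

theorem inner_gradient_objective (hα : InformationBounds h y M αm αp) (hM : 0 < M)
    {Z : Param p q κ n} (hZ : BoundedActivation Xdata Xaux M Z) (W : Param p q κ n) :
    inner ℝ (gradient (objective h ξ ν Xdata Xaux y) Z) W =
      objectiveDeriv h ξ ν Xdata Xaux y Z W := by
  have h1 := (differentiableAt_objective (ξ := ξ) (ν := ν) hα hM hZ).hasFDerivAt
  have h2 : HasDerivAt (fun t : ℝ => objective h ξ ν Xdata Xaux y (Z + t • W))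
      (fderiv ℝ (objective h ξ ν Xdata Xaux y) Z W) 0 := by
    have hl : HasDerivAt (fun t : ℝ => Z + t • W) W 0 := by
      simpa using ((hasDerivAt_id (0 : ℝ)).smul_const W).const_add Z
    rw [show Z = Z + (0 : ℝ) • W by simp] at h1
    have := h1.comp_hasDerivAt (0 : ℝ) hl
    simpa [Function.comp_def] using this
  have h3 := hasDerivAt_objective_line (ξ := ξ) (ν := ν) hα hM (Z := Z) W (t := 0)
    (by simpa using hZ)
  rw [zero_smul, add_zero] at h3
  rw [← h2.unique h3, gradient, InnerProductSpace.toDual_symm_apply]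

/-- The form has no cross terms between `B` and the pair `(A, Γ)`. The `B` part is exactly `2ξ
‖B‖²`; on the pair, the information bounds and then the covariance bounds give curvature between `2ν
+ n μs` and `2ν + n Ls`. -/
theorem objectiveHess_bounds (hα : InformationBounds h y M αm αp) (hM : 0 < M)
    (hδ : CovarianceBounds Xdata Xaux δm δp) {μs Ls : ℝ} (hμs : μs ≤ δm * αm)
    (hLs : δp * αp ≤ Ls) {Z : Param p q κ n} (hZ : BoundedActivation Xdata Xaux M Z)
    (D : Param p q κ n) :
    min (2 * ξ) (2 * ν + n * μs) * ‖D‖ ^ 2 ≤ objectiveHess h ξ ν Xdata Xaux y Z D D ∧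
      objectiveHess h ξ ν Xdata Xaux y Z D D ≤ max (2 * ξ) (2 * ν + n * Ls) * ‖D‖ ^ 2 := by
  have hq : ∀ s, ∑ j, (∑ i, activation Xdata Xaux D s i *
        scoreHess h (y s) (activation Xdata Xaux Z s) i j) * activation Xdata Xaux D s j =
      activation Xdata Xaux D s ⬝ᵥ scoreHess h (y s) (activation Xdata Xaux Z s) *ᵥ
        activation Xdata Xaux D s := by
    intro s
    rw [Matrix.dotProduct_mulVec]
    rfl
  have hdot : ∀ s, activation Xdata Xaux D s ⬝ᵥ activation Xdata Xaux D s =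
      ∑ j, activation Xdata Xaux D s j ^ 2 := fun s => by simp [dotProduct, sq]
  have hlow : αm * (∑ s, ∑ j, activation Xdata Xaux D s j ^ 2) ≤
      ∑ s, ∑ j, (∑ i, activation Xdata Xaux D s i *
        scoreHess h (y s) (activation Xdata Xaux Z s) i j) * activation Xdata Xaux D s j := by
    rw [Finset.mul_sum]
    refine Finset.sum_le_sum fun s _ => ?_
    rw [hq, ← hdot]
    exact (hα.quadratic_bounds hM s (hZ s) _).1
  have hupp : ∑ s, ∑ j, (∑ i, activation Xdata Xaux D s i *
        scoreHess h (y s) (activation Xdata Xaux Z s) i j) * activation Xdata Xaux D s j ≤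
      αp * (∑ s, ∑ j, activation Xdata Xaux D s j ^ 2) := by
    rw [Finset.mul_sum]
    refine Finset.sum_le_sum fun s _ => ?_
    rw [hq, ← hdot]
    exact (hα.quadratic_bounds hM s (hZ s) _).2
  obtain ⟨hc1, hc2⟩ := hδ.sum_activation_sq D
  simp only [objectiveHess, LinearMap.mk₂_apply]
  rw [norm_sq_eq_blocks]
  simp only [← sq]
  set a := ∑ i, ∑ j, matA D i j ^ 2
  set b := ∑ i, ∑ s, matB D i s ^ 2
  set g := ∑ k, ∑ j, matG D k j ^ 2
  set act := ∑ s, ∑ j, activation Xdata Xaux D s j ^ 2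
  have ha : 0 ≤ a := by positivity
  have hb : 0 ≤ b := by positivity
  have hg : 0 ≤ g := by positivity
  have hn : (0 : ℝ) ≤ n := Nat.cast_nonneg n
  have hnag : 0 ≤ n * (a + g) := by positivity
  constructor
  · have h1 := mul_le_mul_of_nonneg_left hc1 hα.alpham_pos.le
    have h2 := mul_le_mul_of_nonneg_right hμs hnag
    have h3 := mul_le_mul_of_nonneg_right (min_le_left (2 * ξ) (2 * ν + n * μs)) hb
    have h4 := mul_le_mul_of_nonneg_right (min_le_right (2 * ξ) (2 * ν + n * μs)) (add_nonneg ha hg)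
    linarith
  · have h1 := mul_le_mul_of_nonneg_left hc2 hα.alphap_pos.le
    have h2 := mul_le_mul_of_nonneg_right hLs hnag
    have h3 := mul_le_mul_of_nonneg_right (le_max_left (2 * ξ) (2 * ν + n * Ls)) hb
    have h4 := mul_le_mul_of_nonneg_right (le_max_right (2 * ξ) (2 * ν + n * Ls)) (add_nonneg ha hg)
    linarith

/-- Mean value theorem for the gradient of the objective. -/
theorem exists_inner_gradient_sub_eq (hα : InformationBounds h y M αm αp) (hM : 0 < M)
    {Z Zs : Param p q κ n} (hZ : BoundedActivation Xdata Xaux M Z)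
    (hZs : BoundedActivation Xdata Xaux M Zs) (W : Param p q κ n) :
    ∃ Z', BoundedActivation Xdata Xaux M Z' ∧
      inner ℝ (gradient (objective h ξ ν Xdata Xaux y) Z
        - gradient (objective h ξ ν Xdata Xaux y) Zs) W =
      objectiveHess h ξ ν Xdata Xaux y Z' (Z - Zs) W := by
  have hder : ∀ t ∈ Set.Icc (0 : ℝ) 1, HasDerivAt
      (fun t : ℝ => objectiveDeriv h ξ ν Xdata Xaux y (Zs + t • (Z - Zs)) W)
      (objectiveHess h ξ ν Xdata Xaux y (Zs + t • (Z - Zs)) (Z - Zs) W) t := fun t ht =>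
    hasDerivAt_objectiveDeriv_line hα hM _ _ (hZs.line hZ ht)
  obtain ⟨t, ht, heq⟩ := exists_hasDerivAt_eq_slope _ _ one_pos
    (fun t ht => (hder t ht).continuousAt.continuousWithinAt)
    (fun t ht => hder t (Set.Ioo_subset_Icc_self ht))
  refine ⟨_, hZs.line hZ (Set.Ioo_subset_Icc_self ht), ?_⟩
  rw [heq, inner_sub_left, inner_gradient_objective hα hM hZ, inner_gradient_objective hα hM hZs]
  simp

/-- The difference of the two steps is governed by the symmetric form `I - τ Hess`, whose diagonal
values are at most `η ‖v‖²` in modulus. -/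
theorem gradient_step_contraction (hα : InformationBounds h y M αm αp) (hM : 0 < M)
    (hδ : CovarianceBounds Xdata Xaux δm δp) {μs Ls : ℝ} (hμs : μs ≤ δm * αm)
    (hLs : δp * αp ≤ Ls) {μ L : ℝ} (hμ : μ = min (2 * ξ) (2 * ν + n * μs))
    (hL : L = max (2 * ξ) (2 * ν + n * Ls)) {τ : ℝ} (hτ : 0 ≤ τ) {f : Param p q κ n → ℝ}
    (hf : f = objective h ξ ν Xdata Xaux y)
    {Z Zs : Param p q κ n} (hZ : BoundedActivation Xdata Xaux M Z)
    (hZs : BoundedActivation Xdata Xaux M Zs) :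
    ‖(Z - τ • gradient f Z) - (Zs - τ • gradient f Zs)‖
      ≤ max |1 - τ * μ| |1 - τ * L| * ‖Z - Zs‖ := by
  subst hf
  set f := objective h ξ ν Xdata Xaux y
  set V := (Z - τ • gradient f Z) - (Zs - τ • gradient f Zs) with hV
  -- The mean-value point depends on the test direction, so the direction is taken to be `V` itself:
  -- then `‖V‖² = T (Z - Zs) V`, and a factor `‖V‖` cancels.
  obtain ⟨Z', hZ', heq⟩ := exists_inner_gradient_sub_eq (ξ := ξ) (ν := ν) hα hM hZ hZs V
  have hV' : V = (Z - Zs) - τ • (gradient f Z - gradient f Zs) := by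
    rw [hV, smul_sub]; abel
  let T : Param p q κ n →ₗ[ℝ] Param p q κ n →ₗ[ℝ] ℝ :=
    innerₗ (Param p q κ n) - τ • objectiveHess h ξ ν Xdata Xaux y Z'
  have hT : ∀ v w, T v w = inner ℝ v w - τ * objectiveHess h ξ ν Xdata Xaux y Z' v w :=
    fun v w => rfl
  have hVV : ‖V‖ ^ 2 = T (Z - Zs) V := by
    rw [hT, ← heq, ← real_inner_self_eq_norm_sq]
    nth_rewrite 1 [hV']
    rw [inner_sub_left, inner_smul_left]
    rfl
  have hb := bilin_le_of_diagonal_le (T := T) (η := max |1 - τ * μ| |1 - τ * L|)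
    (fun v w => by rw [hT, hT, objectiveHess_symm, real_inner_comm]) (fun v => by
      obtain ⟨h1, h2⟩ := objectiveHess_bounds (ξ := ξ) (ν := ν) hα hM hδ hμs hLs hZ' v
      rw [← hμ] at h1
      rw [← hL] at h2
      rw [hT, real_inner_self_eq_norm_sq]
      have h3 := mul_le_mul_of_nonneg_left h1 hτ
      have h4 := mul_le_mul_of_nonneg_left h2 hτ
      have h5 := mul_le_mul_of_nonneg_right
        ((le_abs_self _).trans (le_max_left |1 - τ * μ| |1 - τ * L|)) (sq_nonneg ‖v‖)
      have h6 := mul_le_mul_of_nonneg_right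
        ((neg_le_abs _).trans (le_max_right |1 - τ * μ| |1 - τ * L|)) (sq_nonneg ‖v‖)
      rw [abs_le]
      constructor <;> linarith) (Z - Zs) V
  rw [← hVV] at hb
  rcases (norm_nonneg V).eq_or_lt with h0 | h0
  · rw [← h0]
    exact mul_nonneg ((abs_nonneg _).trans (le_max_left _ _)) (norm_nonneg _)
  · refine le_of_mul_le_mul_right ?_ h0
    linarith

/-- The mean value theorem is used twice: for `f` on the segment, then for the gradient between `Zs`
and the intermediate point. The factor `t < 1` is discarded. -/
theorem objective_sub_le (hα : InformationBounds h y M αm αp) (hM : 0 < M)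
    (hδ : CovarianceBounds Xdata Xaux δm δp) {μs Ls : ℝ} (hμs : μs ≤ δm * αm)
    (hLs : δp * αp ≤ Ls) {L : ℝ} (hL : L = max (2 * ξ) (2 * ν + n * Ls)) (hL0 : 0 ≤ L)
    {f : Param p q κ n → ℝ} (hf : f = objective h ξ ν Xdata Xaux y)
    {Z Zs : Param p q κ n} (hZ : BoundedActivation Xdata Xaux M Z)
    (hZs : BoundedActivation Xdata Xaux M Zs) :
    f Z - f Zs ≤ (‖gradient f Zs‖ + L * ‖Z - Zs‖) * ‖Z - Zs‖ := by
  subst hf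
  set f := objective h ξ ν Xdata Xaux y
  have hder : ∀ t ∈ Set.Icc (0 : ℝ) 1, HasDerivAt (fun t : ℝ => f (Zs + t • (Z - Zs)))
      (objectiveDeriv h ξ ν Xdata Xaux y (Zs + t • (Z - Zs)) (Z - Zs)) t := fun t ht =>
    hasDerivAt_objective_line hα hM _ (hZs.line hZ ht)
  obtain ⟨t, ht, heq⟩ := exists_hasDerivAt_eq_slope _ _ one_pos
    (fun t ht => (hder t ht).continuousAt.continuousWithinAt)
    (fun t ht => hder t (Set.Ioo_subset_Icc_self ht))
  have hbt := hZs.line hZ (Set.Ioo_subset_Icc_self ht)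
  obtain ⟨Z', hZ', hH⟩ := exists_inner_gradient_sub_eq (ξ := ξ) (ν := ν) hα hM hbt hZs (Z - Zs)
  rw [inner_sub_left, inner_gradient_objective hα hM hbt, heq, add_sub_cancel_left, map_smul,
    LinearMap.smul_apply, smul_eq_mul] at hH
  simp only [one_smul, zero_smul, add_zero, sub_zero, div_one, add_sub_cancel] at hH
  have h2 := (objectiveHess_bounds (ξ := ξ) (ν := ν) hα hM hδ hμs hLs hZ' (Z - Zs)).2
  rw [← hL] at h2
  have h3 := mul_le_mul_of_nonneg_left h2 ht.1.le
  have h4 : t * (L * ‖Z - Zs‖ ^ 2) ≤ L * ‖Z - Zs‖ ^ 2 :=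
    mul_le_of_le_one_left (mul_nonneg hL0 (sq_nonneg _)) ht.2.le
  have h5 := real_inner_le_norm (gradient f Zs) (Z - Zs)
  linarith

end Objective

end SDL

/-! ### Convergence of the iterates -/

theorem mainTheorem2 {p q κ n : ℕ} (r : ℕ)
    (Xdata : Matrix (Fin p) (Fin n) ℝ) (Xaux : Matrix (Fin q) (Fin n) ℝ)
    (y : Fin n → Fin (κ + 1)) (h : ℝ → ℝ) (ξ ν : ℝ) (hν : 0 ≤ ν)
    (Θ : Set (SDL.Param p q κ n)) (hΘ : Convex ℝ Θ)
    (M : ℝ) (hM : 0 < M)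
    (δm δp : ℝ) (hδ : SDL.CovarianceBounds Xdata Xaux δm δp)
    (αm αp : ℝ) (hα : SDL.InformationBounds h y M αm αp)
    (μs Ls : ℝ) (hμs : μs ≤ δm * αm) (hLs : δp * αp ≤ Ls)
    (μ L : ℝ) (hμ : μ = min (2 * ξ) (2 * ν + n * μs)) (hL : L = max (2 * ξ) (2 * ν + n * Ls))
    (hμ_pos : 0 < μ) (hcond : L / μ < 3)
    (τ : ℝ) (hτ_lower : 1 / (2 * μ) < τ) (hτ_upper : τ < 3 / (2 * L))
    (ρ : ℝ) (hρ : ρ = 2 * max |1 - τ * μ| |1 - τ * L|)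
    (f : SDL.Param p q κ n → ℝ) (hf : f = SDL.objective h ξ ν Xdata Xaux y)
    (N : ℕ) (Z : ℕ → SDL.Param p q κ n) (hZ : SDL.IsLPGDRun f Θ r τ N Z)
    (hZ_bdd : ∀ t ≤ N, SDL.BoundedActivation Xdata Xaux M (Z t)) :
    (0 ≤ ρ ∧ ρ < 1 ∧ (¬ (μ = L ∧ τ = 1 / μ) → 0 < ρ)) ∧
    (∀ Zs ∈ Θ, (SDL.matX Zs).rank ≤ r → SDL.BoundedActivation Xdata Xaux M Zs →
      ∀ G, SDL.IsGradientMapping f Θ τ Zs G →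
        ∀ t, 1 ≤ t → t ≤ N →
          ‖Z t - Zs‖ ≤ ρ ^ t * ‖Z 0 - Zs‖
            + 2 * τ / (1 - ρ) *
              (√(3 * r) * SDL.opNorm (SDL.matX G) + SDL.frobNorm (SDL.matG G))) ∧
    (∀ Zs, SDL.IsStationary f Θ Zs → (SDL.matX Zs).rank ≤ r →
      SDL.BoundedActivation Xdata Xaux M Zs →
        ∀ t, 1 ≤ t → t ≤ N →
          ‖Z t - Zs‖ ≤ ρ ^ t * ‖Z 0 - Zs‖ ∧
          f (Z t) - f Zs ≤
            (‖gradient f Zs‖ + L * ρ ^ t * ‖Z 0 - Zs‖) * ρ ^ t * ‖Z 0 - Zs‖) := by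
  -- The comparison goes through `2ξ`, with no ordering of `μs` and `Ls` required.
  have hμL : μ ≤ L := by
    rw [hμ, hL]; exact (min_le_left _ _).trans (le_max_left _ _)
  have hL0 : 0 < L := hμ_pos.trans_le hμL
  have hτ0 : 0 < τ := (by positivity : 0 < 1 / (2 * μ)).trans hτ_lower
  rw [div_lt_iff₀ (by positivity)] at hτ_lower
  rw [lt_div_iff₀ (by positivity)] at hτ_upper
  have hτμL : τ * μ ≤ τ * L := mul_le_mul_of_nonneg_left hμL hτ0.le
  have hη0 : 0 ≤ max |1 - τ * μ| |1 - τ * L| := (abs_nonneg _).trans (le_max_left _ _)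
  have hρ0 : 0 ≤ ρ := by rw [hρ]; positivity
  have hρ1 : ρ < 1 := by
    -- The stepsize window says `1/2 < τμ ≤ τL < 3/2`.
    have : max |1 - τ * μ| |1 - τ * L| < 1 / 2 :=
      max_lt (abs_lt.2 ⟨by linarith, by linarith⟩) (abs_lt.2 ⟨by linarith, by linarith⟩)
    linarith
  have hconv : ∀ Zs ∈ Θ, (SDL.matX Zs).rank ≤ r → SDL.BoundedActivation Xdata Xaux M Zs →
      ∀ G, SDL.IsGradientMapping f Θ τ Zs G → ∀ t ≤ N,
        ‖Z t - Zs‖ ≤ ρ ^ t * ‖Z 0 - Zs‖ + 2 * τ / (1 - ρ) *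
          (√(3 * r) * SDL.opNorm (SDL.matX G) + SDL.frobNorm (SDL.matG G)) := by
    intro Zs _ hrank hbdd G ⟨P, hP, hG⟩ t
    set ε := √(3 * r) * SDL.opNorm (SDL.matX G) + SDL.frobNorm (SDL.matG G)
    have hε : 0 ≤ ε := add_nonneg
      (mul_nonneg (Real.sqrt_nonneg _) (SDL.opNorm_nonneg _)) (SDL.frobNorm_nonneg _)
    have h1ρ : 0 < 1 - ρ := sub_pos.2 hρ1
    induction t with
    | zero =>
      intro _
      rw [pow_zero, one_mul]
      exact le_add_of_nonneg_right (by positivity)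
    | succ t ih =>
      intro ht
      obtain ⟨Y, hY, hR⟩ := hZ t ht
      have hE : Y - Zs = (Y - P) - τ • G := by
        rw [hG, smul_inv_smul₀ hτ0.ne']; abel
      have h1 := hR.norm_sub_le hτ0.le hrank hE
      have h2 := (hY.norm_sub_le hΘ hP).trans (SDL.gradient_step_contraction hα hM hδ hμs hLs hμ hL
        hτ0.le hf (hZ_bdd t (Nat.le_of_succ_le ht)) hbdd)
      have h3 := mul_le_mul_of_nonneg_left (ih (Nat.le_of_succ_le ht)) hρ0
      -- The additive constant is the fixed point of `c ↦ ρ c + 2τε`, so the induction reproduces it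
      -- exactly.
      have h4 : ρ * (2 * τ / (1 - ρ) * ε) + 2 * (τ * ε) = 2 * τ / (1 - ρ) * ε := by
        field_simp; ring
      have h5 : 2 * (max |1 - τ * μ| |1 - τ * L| * ‖Z t - Zs‖) = ρ * ‖Z t - Zs‖ := by
        rw [hρ]; ring
      rw [pow_succ']
      linarith
  refine ⟨⟨hρ0, hρ1, fun hne => ?_⟩, fun Zs hZs hr hb G hG t _ ht => hconv Zs hZs hr hb G hG t ht,
    fun Zs hst hr hb t _ ht => ?_⟩
  · refine lt_of_le_of_ne hρ0 fun h0 => hne ?_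
    have hmax : max |1 - τ * μ| |1 - τ * L| = 0 := by linarith
    have h1 : 1 - τ * μ = 0 := abs_eq_zero.1 (le_antisymm (hmax ▸ le_max_left _ _) (abs_nonneg _))
    have h2 : 1 - τ * L = 0 := abs_eq_zero.1 (le_antisymm (hmax ▸ le_max_right _ _) (abs_nonneg _))
    refine ⟨mul_left_cancel₀ hτ0.ne' (by linarith), ?_⟩
    rw [eq_div_iff hμ_pos.ne']
    linarith
  · have h1 := hconv Zs hst.1 hr hb 0 (hst.isGradientMapping_zero hτ0.le) t ht
    rw [show SDL.matX (0 : SDL.Param p q κ n) = 0 from rfl,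
      show SDL.matG (0 : SDL.Param p q κ n) = 0 from rfl, SDL.opNorm_zero, SDL.frobNorm_zero,
      mul_zero, add_zero, mul_zero, add_zero] at h1
    refine ⟨h1, (SDL.objective_sub_le hα hM hδ hμs hLs hL hL0.le hf (hZ_bdd t ht) hb).trans ?_⟩
    rw [mul_assoc _ (ρ ^ t), mul_assoc L]
    gcongr
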